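/- Let $\nu>-1$ and let $\rho_\nu(x)=2x^{\nu/2}K_\nu(2\sqrt x)$, $x>0$, where $K_\nu$ is the modified Bessel function of the second kind. Let $(P_n^\nu)_{n\ge 0}$ be a sequence of real polynomials, $\deg P_n^\nu=n$, that is orthonormal with respect to the weight $e^{-x}\rho_\nu(x)$: $$\int_0^\infty P_m^\nu(x)P_n^\nu(x)e^{-x}\rho_\nu(x)\,dx=\delta_{n,m},\qquad n,m\ge 0,$$ and let $\sigma_n\in\{1,-1\}$ be the sign of the leading coefficient of $P_n^\nu$ ($\sigma_n=1$ in the usual normalization). With the Pochhammer symbol $(a)_j$ and the Tricomi function $\Psi(a,b;z)=\frac1{\Gamma(a)}\int_0^\infty e^{-zt}t^{a-1}(1+t)^{b-a-1}dt$ ($a,z>0$), put, for integers $k,m\ge0$, $$d_{k,m}=\Gamma(1+\nu)\sum_{r=0}^k(-1)^{k+r}\binom kr\frac{(1+\nu)_k}{(1+\nu)_r}\,\Gamma(1+\nu+k+r+m)\,\Psi(1+m,\,1-\nu-k-r;\,1).$$ For $n\ge1$ let $D_n=\det(d_{k,m})$ with rows $m=0,\dots,n-1$ and columns $k=1,\dots,n$;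 for $1\le r\le n$ let $D_{n,r}$ be the determinant obtained from $D_n$ by replacing the column $(d_{r,m})_{m}$ by $(d_{0,m})_{m}$; and let $D_{n,0}=-D_n$. Let $(I_-^nf)(x)=\frac1{\Gamma(n)}\int_x^\infty(t-x)^{n-1}f(t)\,dt$ be the Riemann–Liouville integral. Then for every $n\ge1$: $D_n\ne0$, $D_{n,n}\sum_{k=0}^nD_{n,k}(n+k)!\,d_{0,n+k}>0$, the free coefficient $a_{n,0}$ of $P_n^\nu$ is $$a_{n,0}=\sigma_n(-1)^n\,D_n\left(\frac{\Gamma(1+\nu)}{D_{n,n}\sum_{k=0}^nD_{n,k}\,(n+k)!\,d_{0,n+k}}\right)^{1/2},$$ and for all $x>0$ the Rodrigues-type formula $$P_n^\nu(x)=\frac{(-1)^{n+1}a_{n,0}}{D_n}\sum_{r=0}^nD_{n,r}\,r!\,(1+\nu)_r\sum_{k=0}^{2r}\frac1{k!}\,{}_3F_2(-k,1+\nu+r,1+r;\,1+\nu,1;\,1)\;\frac{e^x}{\rho_\nu(x)}\,\frac{d^n}{dx^n}\Big[e^{-x}\frac{d^k}{dx^k}\Big[e^x\,I_-^n\big(t^ke^{-t}\rho_\nu(t)\big)(x)\Big]\Big]$$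 holds, where the integrals converge and each function $e^xI_-^n(t^ke^{-t}\rho_\nu(t))(x)$, $0\le k\le 2n$, is $n+k$ times continuously differentiable on $(0,\infty)$. -/

import Mathlib

namespace PrudnikovOrth

open MeasureTheory Set Polynomial

/-- The modified Bessel function of the second kind (Macdonald function) of real order `ν`
at `z > 0`, by its classical integral `K_ν(z) = ∫_0^∞ e^{-z cosh u} cosh(νu) du`. -/
noncomputable def macdonaldK (ν z : ℝ) : ℝ :=
  ∫ u in Ioi (0 : ℝ), Real.exp (-z * Real.cosh u) * Real.cosh (ν * u)

/-- The scaled Macdonald function `ρ_ν(x) = 2 x^{ν/2} K_ν(2√x)`, `x > 0`. -/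
noncomputable def rho (ν x : ℝ) : ℝ :=
  2 * x ^ (ν / 2) * macdonaldK ν (2 * Real.sqrt x)

/-- `(P_n)` is a sequence of real polynomials, `P_n` of exact degree `n`, that is orthonormal on
`(0, ∞)` with respect to the weight `e^{-x} ρ_ν(x)`. -/
structure IsOrthonormalSeq (ν : ℝ) (P : ℕ → ℝ[X]) : Prop where
  degree_eq : ∀ n, (P n).degree = n
  orthonormal : ∀ m n,
    ∫ x in Ioi (0 : ℝ), (P m).eval x * (P n).eval x * (Real.exp (-x) * rho ν x)
      = if n = m then 1 else 0

/-- The Pochhammer symbol `(a)_j = a (a + 1) ⋯ (a + j - 1)`. -/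
noncomputable def poch (a : ℝ) (j : ℕ) : ℝ := (ascPochhammer ℝ j).eval a

/-- The generalized hypergeometric series `₃F₂(a, b, c; d, e; z)`. -/
noncomputable def hyp3F2 (a b c d e z : ℝ) : ℝ :=
  ∑' j : ℕ, poch a j * poch b j * poch c j / (poch d j * poch e j * (j.factorial : ℝ)) * z ^ j

/-- The Tricomi confluent hypergeometric function `Ψ(a, b; z)` for `a > 0`, `z > 0`. -/
noncomputable def tricomi (a b z : ℝ) : ℝ :=
  (Real.Gamma a)⁻¹ *
    ∫ t in Ioi (0 : ℝ), Real.exp (-z * t) * t ^ (a - 1) * (1 + t) ^ (b - a - 1)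

/-- The Riemann–Liouville fractional integral
`(I_-^α f)(x) = Γ(α)⁻¹ ∫_x^∞ (t - x)^{α - 1} f(t) dt`, `α > 0`. -/
noncomputable def rlIntegral (α : ℝ) (f : ℝ → ℝ) (x : ℝ) : ℝ :=
  (Real.Gamma α)⁻¹ * ∫ t in Ioi x, (t - x) ^ (α - 1) * f t

/-- The numbers `d_{k,m}`. -/
noncomputable def dCoeff (ν : ℝ) (k m : ℕ) : ℝ :=
  Real.Gamma (1 + ν) * ∑ r ∈ Finset.range (k + 1),
    (-1) ^ (k + r) * (k.choose r : ℝ) * (poch (1 + ν) k / poch (1 + ν) r) *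
      Real.Gamma (1 + ν + k + r + m) * tricomi (1 + m) (1 - ν - k - r) 1

/-- The determinant `D_n` of the matrix with rows `m = 0, …, n - 1`, columns `k = 1, …, n` and
entries `d_{k,m}`. -/
noncomputable def detD (ν : ℝ) (n : ℕ) : ℝ :=
  (Matrix.of fun m j : Fin n => dCoeff ν (j + 1) m).det

/-- The determinant `D_{n,r}`: for `1 ≤ r ≤ n` the column of the `d_{r,m}` in `D_n` is replaced by
the column of the `d_{0,m}`; by convention `D_{n,0} = -D_n`. -/
noncomputable def detDr (ν : ℝ) (n r : ℕ) : ℝ :=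
  if r = 0 then -detD ν n
  else (Matrix.of fun m j : Fin n =>
    if (j : ℕ) + 1 = r then dCoeff ν 0 m else dCoeff ν (j + 1) m).det

/-- The sum `S_n = ∑_{k=0}^n D_{n,k} (n + k)! d_{0,n+k}`. -/
noncomputable def sumS (ν : ℝ) (n : ℕ) : ℝ :=
  ∑ k ∈ Finset.range (n + 1), detDr ν n k * ((n + k).factorial : ℝ) * dCoeff ν 0 (n + k)

/-- The free coefficient `a_{n,0}` of `P_n`; `σ` is the sign of the leading coefficient of `P_n`
(so `σ = 1` in the usual normalization). -/
noncomputable def freeCoeff (ν : ℝ) (n : ℕ) (σ : ℝ) : ℝ :=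
  σ * (-1) ^ n * (detD ν n * Real.sqrt (Real.Gamma (1 + ν) / (detDr ν n n * sumS ν n)))

/-- The function `y ↦ e^y I_-^n (t^k e^{-t} ρ_ν(t)) (y)`. -/
noncomputable def innerFun (ν : ℝ) (n k : ℕ) (y : ℝ) : ℝ :=
  Real.exp y * rlIntegral n (fun t => t ^ k * Real.exp (-t) * rho ν t) y

/-- The expression
`(e^x / ρ_ν(x)) dⁿ/dxⁿ [ e^{-x} d^k/dx^k [ e^x I_-^n (t^k e^{-t} ρ_ν(t)) (x) ] ]`. -/
noncomputable def rodriguesTerm (ν : ℝ) (n k : ℕ) (x : ℝ) : ℝ :=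
  Real.exp x / rho ν x *
    iteratedDeriv n (fun y => Real.exp (-y) * iteratedDeriv k (innerFun ν n k) y) x

end PrudnikovOrth

open MeasureTheory Set Polynomial PrudnikovOrth

/-!
Write `μ_j` for the moments of the weight `e^{-x} ρ_ν(x)`, `D = d/dx` and `θ = x D`.

The function `ρ_μ(x)` is the integral over `u ∈ ℝ` of `exp (μ u - e^u - x e^{-u})`
(`rho_eq_integral`). Differentiating under the integral and integrating a derivative over the line
give `ρ_μ' = -ρ_{μ-1}` and `ρ_{μ+1} = μ ρ_μ + x ρ_{μ-1}`, hence smoothness of `ρ_ν`, Bessel's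
equation `θ (θ - ν) ρ_ν = x ρ_ν`, and an expansion of `x^k ρ_ν` in `ρ_{ν+k}, …, ρ_{ν+2k}` whose
coefficients are those in the definition of `d_{k,m}`. Since the moments of each `ρ_μ` are
values of the Tricomi function, `d_{k,m} = Γ(1 + ν) μ_{m+k} / m!` (`dCoeff_eq_moment`).

So the determinants are Hankel determinants of moments up to explicit factors: `D_n > 0`, and
`D_{n,n}` has the sign `(-1)^{n-1}`. The orthogonality of `P_n` to `1, …, x^{n-1}` is a linear
system for its coefficients, which Cramer's rule solves as `a_{n,r} D_n = -a_{n,0} D_{n,r}`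
(`IsOrthonormalSeq.coeff_mul_detD`). The normalization then yields
`D_{n,n} S_n a_{n,0}^2 = Γ(1 + ν) D_n^2`, and the sign of `a_{n,n}` determines that of `a_{n,0}`.

For the Rodrigues-type formula, `D^n` commutes with `e^{-x} D^k e^x = (D + 1)^k` and
`D^n I_-^n = (-1)^n`, so the `k`-th term is `(-1)^n D^k (x^k ρ_ν) / ρ_ν` (`rodriguesTerm_eq`). By
linearity it remains to expand `x^r ρ_ν` in the functions `D^k (x^k ρ_ν)`. Both are polynomials in
`θ` applied to `ρ_ν`: the first is `∏_{j<r} (θ - j) (θ - ν - j) ρ_ν`, by Bessel's equation, and the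
second is `(θ + 1)_k ρ_ν`. As the `(X + 1)_k` are the Newton basis at the nodes `-1, -2, …`, the
coefficients are divided differences of the first polynomial, that is, alternating binomial sums of
its values at the nodes, which are multiples of the terminating `₃F₂` sums (`prod_eq_sum_hyp3F2`).
-/

namespace PrudnikovOrth

open MeasureTheory Set Polynomial

/-! ### The Macdonald weight as an integral over the line -/

/-- The kernel `exp (μ u - e^u - x e^{-u})`, whose integral over `u ∈ ℝ` is `ρ_μ(x)`; with `s = e^u`
this is the kernel `s^{μ-1} e^{-s-x/s} ds` on the half-line. -/
noncomputable def rhoKernel (μ x u : ℝ) : ℝ :=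
  Real.exp (μ * u - Real.exp u - x * Real.exp (-u))

theorem rhoKernel_pos (μ x u : ℝ) : 0 < rhoKernel μ x u := Real.exp_pos _

theorem continuous_rhoKernel (μ x : ℝ) : Continuous (rhoKernel μ x) := by
  unfold rhoKernel; fun_prop

theorem integrableOn_Ioi_iff_integrable_exp (g : ℝ → ℝ) :
    IntegrableOn g (Ioi 0) ↔ Integrable (fun u => Real.exp u * g (Real.exp u)) := by
  have h := integrableOn_image_iff_integrableOn_abs_deriv_smul (s := univ) (f := Real.exp)
    (f' := Real.exp) MeasurableSet.univ (fun x _ => (Real.hasDerivAt_exp x).hasDerivWithinAt)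
    Real.exp_injective.injOn g
  rw [image_univ, Real.range_exp, integrableOn_univ] at h
  simpa [abs_of_pos, Real.exp_pos] using h

theorem integral_Ioi_eq_integral_exp (g : ℝ → ℝ) :
    ∫ s in Ioi 0, g s = ∫ u, Real.exp u * g (Real.exp u) := by
  have h := integral_image_eq_integral_abs_deriv_smul (s := univ) (f := Real.exp)
    (f' := Real.exp) MeasurableSet.univ (fun x _ => (Real.hasDerivAt_exp x).hasDerivWithinAt)
    Real.exp_injective.injOn g
  rw [image_univ, Real.range_exp, setIntegral_univ] at h
  simpa [abs_of_pos, Real.exp_pos] using h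

theorem integrable_exp_mul_sub_exp {a : ℝ} (ha : 0 < a) :
    Integrable (fun u : ℝ => Real.exp (a * u - Real.exp u)) := by
  have h := (integrableOn_Ioi_iff_integrable_exp _).1 (Real.GammaIntegral_convergent ha)
  refine h.congr (ae_of_all _ fun u => ?_)
  simp only
  rw [← Real.exp_mul, ← Real.exp_add, ← Real.exp_add]
  ring_nf

theorem integrable_rhoKernel (μ : ℝ) {x : ℝ} (hx : 0 < x) : Integrable (rhoKernel μ x) := by
  obtain ⟨N, hN⟩ := exists_nat_gt (-μ)
  have hN' : 0 < μ + N := by linarith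
  refine ((integrable_exp_mul_sub_exp hN').const_mul (N.factorial / x ^ N)).mono'
    (continuous_rhoKernel μ x).aestronglyMeasurable (ae_of_all _ fun u => ?_)
  rw [Real.norm_of_nonneg (rhoKernel_pos μ x u).le]
  -- the elementary bound `y ^ N / N! ≤ e ^ y` at `y = x e^{-u}` tames the kernel at `u → -∞`
  have hy : 0 < x * Real.exp (-u) := by positivity
  have h1 := Real.pow_div_factorial_le_exp _ hy.le N
  have h2 : Real.exp (-(x * Real.exp (-u))) ≤ N.factorial / x ^ N * Real.exp (N * u) := by
    rw [Real.exp_neg]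
    calc (Real.exp (x * Real.exp (-u)))⁻¹ ≤ ((x * Real.exp (-u)) ^ N / N.factorial)⁻¹ :=
          inv_anti₀ (by positivity) h1
      _ = N.factorial / x ^ N * Real.exp (N * u) := by
          rw [mul_pow, ← Real.exp_nat_mul, inv_div, mul_neg, Real.exp_neg]
          field_simp
  calc rhoKernel μ x u = Real.exp (μ * u - Real.exp u) * Real.exp (-(x * Real.exp (-u))) := by
        rw [rhoKernel, ← Real.exp_add]; ring_nf
    _ ≤ Real.exp (μ * u - Real.exp u) * (N.factorial / x ^ N * Real.exp (N * u)) := by gcongr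
    _ = N.factorial / x ^ N * Real.exp ((μ + N) * u - Real.exp u) := by
        rw [mul_left_comm, ← Real.exp_add]; ring_nf

/-- Translation by `log √x` symmetrizes `e^u + x e^{-u}` into `2 √x cosh u`. -/
theorem rhoKernel_add_log_sqrt (μ : ℝ) {x : ℝ} (hx : 0 < x) (u : ℝ) :
    rhoKernel μ x (u + Real.log (Real.sqrt x)) =
      x ^ (μ / 2) * (Real.exp (-(2 * Real.sqrt x) * Real.cosh u) * Real.exp (μ * u)) := by
  have hs : 0 < Real.sqrt x := Real.sqrt_pos.2 hx
  have hxx : Real.sqrt x * Real.sqrt x = x := Real.mul_self_sqrt hx.le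
  have h3 : x * (Real.sqrt x)⁻¹ = Real.sqrt x := by
    nth_rw 1 [← hxx]; field_simp
  rw [rhoKernel, neg_add, Real.exp_add, Real.exp_add (-u), Real.exp_neg (Real.log _),
    Real.exp_log hs, Real.rpow_def_of_pos hx, ← Real.exp_add, ← Real.exp_add, Real.cosh_eq,
    Real.log_sqrt hx.le]
  congr 1
  linear_combination (-Real.exp (-u)) * h3

theorem rho_eq_integral (μ : ℝ) {x : ℝ} (hx : 0 < x) : rho μ x = ∫ u, rhoKernel μ x u := by
  set z := 2 * Real.sqrt x with hz
  have hc : 0 < x ^ (μ / 2) := Real.rpow_pos_of_pos hx _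
  have hint : Integrable fun u : ℝ => Real.exp (-z * Real.cosh u) * Real.exp (μ * u) := by
    have h := ((integrable_rhoKernel μ hx).comp_add_right (Real.log (Real.sqrt x))).const_mul
      (x ^ (μ / 2))⁻¹
    refine h.congr (ae_of_all _ fun u => ?_)
    simp only [rhoKernel_add_log_sqrt μ hx, ← hz]
    field_simp
  have hint' : Integrable fun u : ℝ => Real.exp (-z * Real.cosh u) * Real.exp (-(μ * u)) := by
    simpa [Real.cosh_neg] using hint.comp_neg
  have heq : ∫ u, Real.exp (-z * Real.cosh u) * Real.exp (-(μ * u)) =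
      ∫ u, Real.exp (-z * Real.cosh u) * Real.exp (μ * u) := by
    rw [← integral_neg_eq_self]
    simp [Real.cosh_neg]
  have h1 : ∫ u, Real.exp (-z * Real.cosh u) * Real.cosh (μ * u) =
      ∫ u, Real.exp (-z * Real.cosh u) * Real.exp (μ * u) := by
    calc _ = ∫ u, 2⁻¹ * (Real.exp (-z * Real.cosh u) * Real.exp (μ * u) +
          Real.exp (-z * Real.cosh u) * Real.exp (-(μ * u))) := by
          congr 1; ext u; rw [Real.cosh_eq (μ * u)]; ring
      _ = _ := by
          rw [integral_const_mul, integral_add hint hint', heq]; ring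
  have h2 : ∫ u, Real.exp (-z * Real.cosh u) * Real.cosh (μ * u) = 2 * macdonaldK μ z := by
    rw [macdonaldK, ← integral_comp_abs]
    congr 1; ext u
    rw [Real.cosh_abs]
    rcases abs_cases u with ⟨h, -⟩ | ⟨h, -⟩ <;> simp [h]
  rw [← integral_add_right_eq_self _ (Real.log (Real.sqrt x))]
  simp only [rhoKernel_add_log_sqrt μ hx]
  rw [integral_const_mul, ← hz, ← h1, h2, rho]
  ring

theorem rho_pos (μ : ℝ) {x : ℝ} (hx : 0 < x) : 0 < rho μ x := by
  rw [rho_eq_integral μ hx]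
  refine (integral_pos_iff_support_of_nonneg (fun u => (rhoKernel_pos μ x u).le)
    (integrable_rhoKernel μ hx)).2 ?_
  have : Function.support (rhoKernel μ x) = univ :=
    eq_univ_of_forall fun u => (rhoKernel_pos μ x u).ne'
  simp [this]

/-! ### Differential and difference relations for the weight -/

theorem hasDerivAt_rho (μ : ℝ) {x : ℝ} (hx : 0 < x) :
    HasDerivAt (rho μ) (-rho (μ - 1) x) x := by
  have hd : ∀ y u : ℝ, HasDerivAt (fun z => rhoKernel μ z u) (-rhoKernel (μ - 1) y u) y := by
    intro y u
    have h := (((hasDerivAt_id y).mul_const (Real.exp (-u))).const_sub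
      (μ * u - Real.exp u)).exp
    refine h.congr_deriv ?_
    simp only [rhoKernel, id]
    rw [one_mul, mul_neg, ← Real.exp_add]
    ring_nf
  have h := (hasDerivAt_integral_of_dominated_loc_of_deriv_le (μ := volume)
    (F := fun z u => rhoKernel μ z u) (F' := fun z u => -rhoKernel (μ - 1) z u)
    (s := Ioi (x / 2)) (bound := rhoKernel (μ - 1) (x / 2)) (Ioi_mem_nhds (by linarith))
    (Filter.Eventually.of_forall fun z => (continuous_rhoKernel μ z).aestronglyMeasurable)
    (integrable_rhoKernel μ hx) (continuous_rhoKernel _ _).neg.aestronglyMeasurable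
    (ae_of_all _ fun u z hz => ?_) (integrable_rhoKernel _ (by linarith))
    (ae_of_all _ fun u z _ => hd z u)).2
  · rw [integral_neg, ← rho_eq_integral _ hx] at h
    refine h.congr_of_eventuallyEq ?_
    filter_upwards [Ioi_mem_nhds hx] with z hz using rho_eq_integral μ hz
  · rw [norm_neg, Real.norm_of_nonneg (rhoKernel_pos _ _ _).le, rhoKernel, rhoKernel]
    have : x / 2 ≤ z := le_of_lt hz
    gcongr

/-- The three-term relation `ρ_{μ+1} = μ ρ_μ + x ρ_{μ-1}`: the integral over the line of the
derivative of the kernel vanishes. -/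
theorem rho_add_one (μ : ℝ) {x : ℝ} (hx : 0 < x) :
    rho (μ + 1) x = μ * rho μ x + x * rho (μ - 1) x := by
  have h0 := integrable_rhoKernel μ hx
  have h1 := integrable_rhoKernel (μ + 1) hx
  have h2 := integrable_rhoKernel (μ - 1) hx
  have h := integral_eq_zero_of_hasDerivAt_of_integrable (f := rhoKernel μ x)
    (f' := fun u => μ * rhoKernel μ x u - rhoKernel (μ + 1) x u + x * rhoKernel (μ - 1) x u)
    (fun u => ?_) (((h0.const_mul μ).sub h1).add (h2.const_mul x)) h0
  · have hs : Integrable fun u => μ * rhoKernel μ x u - rhoKernel (μ + 1) x u :=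
      (h0.const_mul μ).sub h1
    rw [integral_add hs (h2.const_mul x), integral_sub (h0.const_mul μ) h1,
      integral_const_mul, integral_const_mul, ← rho_eq_integral _ hx, ← rho_eq_integral _ hx,
      ← rho_eq_integral _ hx] at h
    linarith
  · have hd := ((((hasDerivAt_id u).const_mul μ).sub (Real.hasDerivAt_exp u)).sub
      (((hasDerivAt_id u).neg.exp).const_mul x)).exp
    refine hd.congr_deriv ?_
    have e1 : rhoKernel (μ + 1) x u = rhoKernel μ x u * Real.exp u := by
      rw [rhoKernel, rhoKernel, ← Real.exp_add]; ring_nf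
    have e2 : rhoKernel (μ - 1) x u = rhoKernel μ x u * Real.exp (-u) := by
      rw [rhoKernel, rhoKernel, ← Real.exp_add]; ring_nf
    simp only [e1, e2]
    simp only [rhoKernel, id]
    simp
    ring

theorem contDiffOn_rho (μ : ℝ) : ContDiffOn ℝ ((⊤ : ℕ∞) : WithTop ℕ∞) (rho μ) (Ioi 0) := by
  rw [contDiffOn_infty]
  intro n
  induction n generalizing μ with
  | zero =>
    exact contDiffOn_zero.2 fun x hx => (hasDerivAt_rho μ hx).continuousAt.continuousWithinAt
  | succ n ih =>
    push_cast
    rw [contDiffOn_succ_iff_deriv_of_isOpen isOpen_Ioi]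
    refine ⟨fun x hx => (hasDerivAt_rho μ hx).differentiableAt.differentiableWithinAt,
      by simp, ?_⟩
    exact (ih (μ - 1)).neg.congr fun x hx => (hasDerivAt_rho μ hx).deriv

/-- Iterating `x ρ_μ = ρ_{μ+2} - (μ + 1) ρ_{μ+1}` expands `x^k ρ_ν` in the functions `ρ_{ν+k+r}`
with exactly the coefficients that define `d_{k,m}`. -/
theorem pow_mul_rho {ν : ℝ} (hν : -1 < ν) (k : ℕ) {x : ℝ} (hx : 0 < x) :
    x ^ k * rho ν x = ∑ r ∈ Finset.range (k + 1),
      (-1) ^ (k + r) * (k.choose r : ℝ) * (poch (1 + ν) k / poch (1 + ν) r) *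
        rho (ν + k + r) x := by
  have hp : ∀ r, poch (1 + ν) r ≠ 0 := fun r => (ascPochhammer_pos r _ (by linarith)).ne'
  have hps : ∀ r, poch (1 + ν) (r + 1) = poch (1 + ν) r * (1 + ν + r) := by
    intro r; rw [poch, poch, ascPochhammer_succ_eval]
  have hν' : ∀ r : ℕ, 1 + ν + r ≠ 0 := fun r => by
    have : (0 : ℝ) ≤ r := r.cast_nonneg
    linarith
  induction k with
  | zero => simp [hp]
  | succ k ih =>
    rw [pow_succ', mul_assoc, ih, Finset.mul_sum]
    have hx2 : ∀ μ, x * rho μ x = rho (μ + 2) x - (μ + 1) * rho (μ + 1) x := by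
      intro μ
      have h := rho_add_one (μ + 1) hx
      rw [add_sub_cancel_right, add_assoc] at h
      norm_num at h
      linarith
    set c : ℕ → ℝ := fun r =>
      (-1) ^ (k + r) * (k.choose r : ℝ) * (poch (1 + ν) k / poch (1 + ν) r) with hc
    have e1 : ∀ r ∈ Finset.range (k + 1), x * (c r * rho (ν + k + r) x) =
        c r * rho (ν + (k + 1 : ℕ) + (r + 1 : ℕ)) x
          - c r * (ν + k + r + 1) * rho (ν + (k + 1 : ℕ) + r) x := by
      intro r _
      rw [mul_left_comm, hx2]
      push_cast
      ring_nf
    rw [Finset.sum_congr rfl e1, Finset.sum_sub_distrib, Finset.sum_range_succ' _ (k + 1)]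
    have e3 : ∑ r ∈ Finset.range (k + 1),
          c r * (ν + k + r + 1) * rho (ν + (k + 1 : ℕ) + r) x =
        ∑ r ∈ Finset.range (k + 1),
          c (r + 1) * (ν + k + (r + 1 : ℕ) + 1) * rho (ν + (k + 1 : ℕ) + (r + 1 : ℕ)) x
          + c 0 * (ν + k + (0 : ℕ) + 1) * rho (ν + (k + 1 : ℕ) + (0 : ℕ)) x := by
      rw [← Finset.sum_range_succ' (fun r => c r * (ν + k + r + 1) * rho (ν + (k + 1 : ℕ) + r) x),
        Finset.sum_range_succ _ (k + 1)]
      simp [hc]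
    rw [e3, ← sub_sub, ← Finset.sum_sub_distrib, sub_eq_add_neg]
    congr 1
    · refine Finset.sum_congr rfl fun r hr => ?_
      rw [← sub_mul]
      congr 1
      simp only [hc, hps]
      have hch : ((k + 1).choose (r + 1) : ℝ) = k.choose r + k.choose (r + 1) := by
        exact_mod_cast Nat.choose_succ_succ k r
      have hch2 : (k.choose (r + 1) : ℝ) * (r + 1) = k.choose r * (k - r) := by
        have h := Nat.choose_succ_right_eq k r
        have hr' : r ≤ k := by simpa [Nat.lt_succ_iff] using hr
        rw [← Nat.cast_sub hr']
        exact_mod_cast h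
      rw [hch]
      have := hp r
      have := hν' r
      field_simp
      simp only [pow_add, pow_one]
      push_cast
      linear_combination poch (1 + ν) k * (-1) ^ k * (-1) ^ r * hch2
    · simp only [hc, hps, Nat.choose_zero_right]
      push_cast
      ring

/-! ### Moments of the weight and the numbers `d_{k,m}` -/

/-- The moment of order `j` of the weight `e^{-x} ρ_ν(x)` on `(0, ∞)`. -/
noncomputable def moment (ν : ℝ) (j : ℕ) : ℝ :=
  ∫ x in Ioi (0 : ℝ), x ^ j * (Real.exp (-x) * rho ν x)

theorem lintegral_pow_mul_exp_neg_mul (m : ℕ) {b : ℝ} (hb : 0 < b) :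
    ∫⁻ x in Ioi (0 : ℝ), ENNReal.ofReal (x ^ m * Real.exp (-(b * x))) =
      ENNReal.ofReal (m.factorial / b ^ (m + 1)) := by
  have h := Real.integral_rpow_mul_exp_neg_mul_Ioi (a := m + 1) (r := b) (by positivity) hb
  have hg : (1 / b) ^ ((m : ℝ) + 1) * Real.Gamma (m + 1) = m.factorial / b ^ (m + 1) := by
    rw [Real.Gamma_nat_eq_factorial, ← Nat.cast_succ, Real.rpow_natCast]
    rw [one_div, inv_pow, div_eq_mul_inv, mul_comm]
  rw [hg] at h
  have hcongr : ∀ x ∈ Ioi (0 : ℝ), x ^ ((m : ℝ) + 1 - 1) * Real.exp (-(b * x)) =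
      x ^ m * Real.exp (-(b * x)) := fun x _ => by rw [add_sub_cancel_right, Real.rpow_natCast]
  rw [setIntegral_congr_fun measurableSet_Ioi hcongr] at h
  rw [← h, ofReal_integral_eq_lintegral_ofReal]
  · refine Integrable.of_integral_ne_zero ?_
    rw [h]; positivity
  · filter_upwards [ae_restrict_mem measurableSet_Ioi] with x hx
    have : (0 : ℝ) < x := hx
    simp only [Pi.zero_apply]; positivity

theorem lintegral_exp_mul_sub_mul_exp {c b : ℝ} (hc : 0 < c) (hb : 0 < b) :
    ∫⁻ u : ℝ, ENNReal.ofReal (Real.exp (c * u - b * Real.exp u)) =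
      ENNReal.ofReal (Real.Gamma c * b ^ (-c)) := by
  have h := Real.integral_rpow_mul_exp_neg_mul_Ioi hc hb
  rw [integral_Ioi_eq_integral_exp] at h
  have hcongr : ∀ u : ℝ, Real.exp u * (Real.exp u ^ (c - 1) * Real.exp (-(b * Real.exp u))) =
      Real.exp (c * u - b * Real.exp u) := fun u => by
    rw [← Real.exp_mul, ← Real.exp_add, ← Real.exp_add]; ring_nf
  simp only [hcongr] at h
  have hg : (1 / b) ^ c * Real.Gamma c = Real.Gamma c * b ^ (-c) := by
    rw [one_div, Real.inv_rpow hb.le, Real.rpow_neg hb.le, mul_comm]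
  rw [hg] at h
  rw [← h, ofReal_integral_eq_lintegral_ofReal]
  · refine Integrable.of_integral_ne_zero ?_
    rw [h]
    have := Real.Gamma_pos_of_pos hc
    positivity
  · exact ae_of_all _ fun u => (Real.exp_pos _).le

theorem aestronglyMeasurable_weight (μ : ℝ) (m : ℕ) :
    AEStronglyMeasurable (fun x => x ^ m * (Real.exp (-x) * rho μ x))
      (volume.restrict (Ioi (0 : ℝ))) := by
  refine ContinuousOn.aestronglyMeasurable ?_ measurableSet_Ioi
  have := (contDiffOn_rho μ).continuousOn
  fun_prop

theorem weight_nonneg (μ : ℝ) (m : ℕ) :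
    0 ≤ᵐ[volume.restrict (Ioi (0 : ℝ))] fun x => x ^ m * (Real.exp (-x) * rho μ x) := by
  filter_upwards [ae_restrict_mem measurableSet_Ioi] with x hx
  have h0 : (0 : ℝ) < x := hx
  have := rho_pos μ h0
  simp only [Pi.zero_apply]; positivity

/-- Tonelli's theorem for the kernel of `ρ_μ`: the inner integral over `x` is a Gamma integral. -/
theorem lintegral_weight (μ : ℝ) (m : ℕ) :
    ∫⁻ x in Ioi (0 : ℝ), ENNReal.ofReal (x ^ m * (Real.exp (-x) * rho μ x)) =
      ∫⁻ u : ℝ, ENNReal.ofReal (m.factorial *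
        (Real.exp ((1 + μ + m) * u - Real.exp u) / (1 + Real.exp u) ^ (m + 1))) := by
  calc _ = ∫⁻ x in Ioi (0 : ℝ), ∫⁻ u : ℝ,
        ENNReal.ofReal (x ^ m * (Real.exp (-x) * rhoKernel μ x u)) := by
        refine setLIntegral_congr_fun measurableSet_Ioi fun x hx => ?_
        have h0 : (0 : ℝ) < x := hx
        rw [rho_eq_integral μ h0, ← integral_const_mul, ← integral_const_mul,
          ofReal_integral_eq_lintegral_ofReal]
        · exact ((integrable_rhoKernel μ h0).const_mul _).const_mul _
        · refine ae_of_all _ fun u => ?_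
          have := rhoKernel_pos μ x u
          simp only [Pi.zero_apply]; positivity
    _ = ∫⁻ u : ℝ, ∫⁻ x in Ioi (0 : ℝ),
        ENNReal.ofReal (x ^ m * (Real.exp (-x) * rhoKernel μ x u)) := by
        refine lintegral_lintegral_swap (Measurable.aemeasurable ?_)
        unfold rhoKernel Function.uncurry
        fun_prop
    _ = _ := by
        refine lintegral_congr fun u => ?_
        have hb : 0 < 1 + Real.exp (-u) := by positivity
        have e : ∀ x : ℝ, ENNReal.ofReal (x ^ m * (Real.exp (-x) * rhoKernel μ x u)) =
            ENNReal.ofReal (Real.exp (μ * u - Real.exp u)) *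
              ENNReal.ofReal (x ^ m * Real.exp (-((1 + Real.exp (-u)) * x))) := by
          intro x
          rw [← ENNReal.ofReal_mul (Real.exp_pos _).le, rhoKernel, mul_left_comm _ (x ^ m),
            ← Real.exp_add, ← Real.exp_add]
          ring_nf
        simp only [e]
        rw [lintegral_const_mul' _ _ ENNReal.ofReal_ne_top, lintegral_pow_mul_exp_neg_mul m hb,
          ← ENNReal.ofReal_mul (Real.exp_pos _).le]
        congr 1
        have e1 : Real.exp ((1 + μ + m) * u - Real.exp u) =
            Real.exp (μ * u - Real.exp u) * Real.exp u ^ (m + 1) := by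
          rw [← Real.exp_nat_mul, ← Real.exp_add]; push_cast; ring_nf
        have e2 : (1 + Real.exp u) = Real.exp u * (1 + Real.exp (-u)) := by
          rw [mul_add, ← Real.exp_add]; simp [add_comm]
        rw [e1, e2, mul_pow]
        have := Real.exp_pos u
        field_simp

/-- The integrand of the Tricomi function, with `Γ(c) (1 + t)^{-c}` opened as a Gamma integral,
leads to the same integral over the line as the moment. -/
theorem lintegral_tricomi {μ : ℝ} (hμ : -1 < μ) (m : ℕ) :
    ∫⁻ t in Ioi (0 : ℝ), ENNReal.ofReal
        (Real.exp (-t) * t ^ m * (Real.Gamma (1 + μ + m) * (1 + t) ^ (-(1 + μ + m)))) =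
      ∫⁻ u : ℝ, ENNReal.ofReal (m.factorial *
        (Real.exp ((1 + μ + m) * u - Real.exp u) / (1 + Real.exp u) ^ (m + 1))) := by
  have hc : 0 < 1 + μ + m := by
    have : (0 : ℝ) ≤ m := m.cast_nonneg
    linarith
  calc _ = ∫⁻ t in Ioi (0 : ℝ), ∫⁻ u : ℝ, ENNReal.ofReal (Real.exp (-t) * t ^ m *
        Real.exp ((1 + μ + m) * u - (1 + t) * Real.exp u)) := by
        refine setLIntegral_congr_fun measurableSet_Ioi fun t ht => ?_
        have h0 : (0 : ℝ) < t := ht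
        have h1 : 0 ≤ Real.exp (-t) * t ^ m := by positivity
        simp only [ENNReal.ofReal_mul h1]
        rw [lintegral_const_mul' _ _ ENNReal.ofReal_ne_top,
          lintegral_exp_mul_sub_mul_exp hc (by linarith)]
    _ = ∫⁻ u : ℝ, ∫⁻ t in Ioi (0 : ℝ), ENNReal.ofReal (Real.exp (-t) * t ^ m *
        Real.exp ((1 + μ + m) * u - (1 + t) * Real.exp u)) := by
        refine lintegral_lintegral_swap (Measurable.aemeasurable ?_)
        unfold Function.uncurry
        fun_prop
    _ = _ := by
        refine lintegral_congr fun u => ?_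
        have hb : 0 < 1 + Real.exp u := by positivity
        have e : ∀ t : ℝ, ENNReal.ofReal (Real.exp (-t) * t ^ m *
              Real.exp ((1 + μ + m) * u - (1 + t) * Real.exp u)) =
            ENNReal.ofReal (Real.exp ((1 + μ + m) * u - Real.exp u)) *
              ENNReal.ofReal (t ^ m * Real.exp (-((1 + Real.exp u) * t))) := by
          intro t
          rw [← ENNReal.ofReal_mul (Real.exp_pos _).le, mul_comm (Real.exp (-t)), mul_assoc,
            mul_left_comm _ (t ^ m), ← Real.exp_add, ← Real.exp_add]
          ring_nf
        simp only [e]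
        rw [lintegral_const_mul' _ _ ENNReal.ofReal_ne_top, lintegral_pow_mul_exp_neg_mul m hb,
          ← ENNReal.ofReal_mul (Real.exp_pos _).le]
        congr 1
        ring

theorem integrableOn_weight {μ : ℝ} (hμ : -1 < μ) (m : ℕ) :
    IntegrableOn (fun x => x ^ m * (Real.exp (-x) * rho μ x)) (Ioi 0) := by
  have hc : 0 < 1 + μ + m := by
    have : (0 : ℝ) ≤ m := m.cast_nonneg
    linarith
  refine ⟨aestronglyMeasurable_weight μ m, ?_⟩
  rw [hasFiniteIntegral_iff_ofReal (weight_nonneg μ m), lintegral_weight]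
  have h : ∫⁻ u : ℝ, ENNReal.ofReal (m.factorial * Real.exp ((1 + μ + m) * u - 1 * Real.exp u))
      < ⊤ := by
    have h0 : (0 : ℝ) ≤ m.factorial := by positivity
    simp only [ENNReal.ofReal_mul h0]
    rw [lintegral_const_mul' _ _ ENNReal.ofReal_ne_top, lintegral_exp_mul_sub_mul_exp hc one_pos]
    exact ENNReal.mul_lt_top ENNReal.ofReal_lt_top ENNReal.ofReal_lt_top
  refine (lintegral_mono fun u => ENNReal.ofReal_le_ofReal ?_).trans_lt h
  rw [one_mul]
  gcongr
  refine div_le_self (Real.exp_pos _).le (one_le_pow₀ ?_)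
  linarith [Real.exp_pos u]

/-- Tonelli's theorem, applied twice, evaluates the moments by the Tricomi function. -/
theorem moment_eq_tricomi {μ : ℝ} (hμ : -1 < μ) (m : ℕ) :
    moment μ m = m.factorial * (Real.Gamma (1 + μ + m) * tricomi (1 + m) (1 - μ) 1) := by
  have hΓ : 0 < Real.Gamma (1 + μ + m) := Real.Gamma_pos_of_pos (by
    have : (0 : ℝ) ≤ m := m.cast_nonneg
    linarith)
  have h1 : moment μ m = ∫ t in Ioi (0 : ℝ),
      Real.exp (-t) * t ^ m * (Real.Gamma (1 + μ + m) * (1 + t) ^ (-(1 + μ + m))) := by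
    rw [moment, integral_eq_lintegral_of_nonneg_ae (weight_nonneg μ m)
      (aestronglyMeasurable_weight μ m), integral_eq_lintegral_of_nonneg_ae,
      lintegral_weight, lintegral_tricomi hμ]
    · filter_upwards [ae_restrict_mem measurableSet_Ioi] with t ht
      have h0 : (0 : ℝ) < t := ht
      simp only [Pi.zero_apply]; positivity
    · exact Measurable.aestronglyMeasurable (by fun_prop)
  have h2 : ∀ t ∈ Ioi (0 : ℝ),
      Real.exp (-t) * t ^ m * (Real.Gamma (1 + μ + m) * (1 + t) ^ (-(1 + μ + m))) =
      Real.Gamma (1 + μ + m) *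
        (Real.exp (-1 * t) * t ^ (1 + (m : ℝ) - 1) * (1 + t) ^ (1 - μ - (1 + m) - 1)) := by
    intro t _
    rw [add_sub_cancel_left, Real.rpow_natCast]
    ring_nf
  rw [h1, setIntegral_congr_fun measurableSet_Ioi h2, integral_const_mul, tricomi,
    add_comm 1 (m : ℝ), Real.Gamma_nat_eq_factorial]
  have : (m.factorial : ℝ) ≠ 0 := by positivity
  field_simp

/-- The numbers `d_{k,m}` are the moments in disguise: `d_{k,m} = Γ(1 + ν) μ_{m+k} / m!`. -/
theorem dCoeff_eq_moment {ν : ℝ} (hν : -1 < ν) (k m : ℕ) :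
    dCoeff ν k m = Real.Gamma (1 + ν) * ((m.factorial : ℝ)⁻¹ * moment ν (m + k)) := by
  have hμ : ∀ r : ℕ, -1 < ν + k + r := fun r => by
    have : (0 : ℝ) ≤ k := k.cast_nonneg
    have : (0 : ℝ) ≤ r := r.cast_nonneg
    linarith
  have hm : (m.factorial : ℝ) ≠ 0 := by positivity
  have h : moment ν (m + k) = ∑ r ∈ Finset.range (k + 1),
      (-1) ^ (k + r) * (k.choose r : ℝ) * (poch (1 + ν) k / poch (1 + ν) r) *
        moment (ν + k + r) m := by
    simp only [moment, ← integral_const_mul]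
    rw [← integral_finsetSum _ fun r _ => (integrableOn_weight (hμ r) m).const_mul _]
    refine setIntegral_congr_fun measurableSet_Ioi fun x hx => ?_
    rw [pow_add, mul_assoc, mul_left_comm (x ^ k), pow_mul_rho hν k hx, Finset.mul_sum,
      Finset.mul_sum]
    exact Finset.sum_congr rfl fun r _ => by ring
  rw [dCoeff, h, Finset.mul_sum (a := (m.factorial : ℝ)⁻¹)]
  congr 1
  refine Finset.sum_congr rfl fun r _ => ?_
  rw [moment_eq_tricomi (hμ r), show 1 + (ν + k + r) + m = 1 + ν + k + r + m by ring,
    show 1 - (ν + k + r) = 1 - ν - k - r by ring]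
  field_simp

/-! ### Hankel determinants and the coefficients of the orthonormal polynomials -/

/-- The integral of a polynomial against the weight `e^{-x} ρ_ν(x)` on `(0, ∞)`. -/
noncomputable def weightIntegral (ν : ℝ) (q : ℝ[X]) : ℝ :=
  ∫ x in Ioi (0 : ℝ), q.eval x * (Real.exp (-x) * rho ν x)

theorem integrableOn_eval_mul_weight {ν : ℝ} (hν : -1 < ν) (q : ℝ[X]) :
    IntegrableOn (fun x => q.eval x * (Real.exp (-x) * rho ν x)) (Ioi 0) := by
  simp only [eval_eq_sum_range, Finset.sum_mul, mul_assoc]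
  exact integrable_finsetSum _ fun i _ => (integrableOn_weight hν i).const_mul _

theorem weightIntegral_add {ν : ℝ} (hν : -1 < ν) (p q : ℝ[X]) :
    weightIntegral ν (p + q) = weightIntegral ν p + weightIntegral ν q := by
  simp only [weightIntegral, eval_add, add_mul]
  exact integral_add (integrableOn_eval_mul_weight hν p) (integrableOn_eval_mul_weight hν q)

theorem weightIntegral_C_mul (ν c : ℝ) (q : ℝ[X]) :
    weightIntegral ν (C c * q) = c * weightIntegral ν q := by
  simp only [weightIntegral, eval_mul, eval_C, mul_assoc, integral_const_mul]

theorem weightIntegral_sum {ν : ℝ} (hν : -1 < ν) {ι : Type*} (s : Finset ι) (f : ι → ℝ[X]) :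
    weightIntegral ν (∑ i ∈ s, f i) = ∑ i ∈ s, weightIntegral ν (f i) := by
  simp only [weightIntegral, eval_finsetSum, Finset.sum_mul]
  exact integral_finsetSum _ fun i _ => integrableOn_eval_mul_weight hν (f i)

theorem weightIntegral_X_pow (ν : ℝ) (j : ℕ) : weightIntegral ν (X ^ j) = moment ν j := by
  simp [weightIntegral, moment]

theorem weightIntegral_pos {ν : ℝ} (hν : -1 < ν) {q : ℝ[X]} (hq : q ≠ 0)
    (hnn : ∀ x : ℝ, 0 < x → 0 ≤ q.eval x) : 0 < weightIntegral ν q := by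
  rw [weightIntegral, setIntegral_pos_iff_support_of_nonneg_ae _
    (integrableOn_eval_mul_weight hν q)]
  · have hsub : Ioi (0 : ℝ) \ (q.roots.toFinset : Set ℝ) ⊆
        (Function.support fun x => q.eval x * (Real.exp (-x) * rho ν x)) ∩ Ioi 0 := by
      rintro x ⟨hx, hxq⟩
      refine ⟨mul_ne_zero (fun h => hxq ?_) (mul_pos (Real.exp_pos _) (rho_pos ν hx)).ne', hx⟩
      simpa [hq] using h
    refine lt_of_lt_of_le ?_ (measure_mono hsub)
    rw [measure_sdiff_null (Finset.measure_zero _ _)]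
    simp
  · filter_upwards [ae_restrict_mem measurableSet_Ioi] with x hx
    exact mul_nonneg (hnn x hx) (mul_pos (Real.exp_pos _) (rho_pos ν hx)).le

/-- Shifted Hankel matrices of the moments are positive definite, being Gram matrices of the
monomials for the weight `x^e e^{-x} ρ_ν(x)`. -/
theorem det_hankel_pos {ν : ℝ} (hν : -1 < ν) (n e : ℕ) :
    0 < (Matrix.of fun i j : Fin n => moment ν (i + j + e)).det := by
  refine (Matrix.PosDef.of_dotProduct_mulVec_pos ?_ fun v hv => ?_).det_pos
  · ext i j
    simp [add_comm (j : ℕ)]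
  set q : ℝ[X] := ∑ i : Fin n, C (v i) * X ^ (i : ℕ) with hq
  have hcoeff : ∀ i : Fin n, q.coeff i = v i := by
    intro i
    simp [hq, coeff_X_pow, Fin.val_inj]
  have hq0 : q ≠ 0 := by
    intro h
    exact hv (funext fun i => by rw [← hcoeff i, h]; simp)
  have hpos := weightIntegral_pos hν (q := q * q * X ^ e)
    (mul_ne_zero (mul_ne_zero hq0 hq0) (pow_ne_zero _ X_ne_zero)) (fun x hx => by
      simp only [eval_mul, eval_pow, eval_X]
      exact mul_nonneg (mul_self_nonneg _) (pow_nonneg hx.le _))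
  refine lt_of_lt_of_eq hpos ?_
  have hexp : q * q * X ^ e =
      ∑ i : Fin n, ∑ j : Fin n, C (v i * v j) * X ^ ((i : ℕ) + j + e) := by
    rw [hq, Finset.sum_mul_sum, Finset.sum_mul]
    refine Finset.sum_congr rfl fun i _ => ?_
    rw [Finset.sum_mul]
    refine Finset.sum_congr rfl fun j _ => ?_
    rw [C_mul, pow_add, pow_add]; ring
  rw [hexp, weightIntegral_sum hν]
  simp only [weightIntegral_sum hν, weightIntegral_C_mul, weightIntegral_X_pow, dotProduct,
    Matrix.mulVec, Finset.mul_sum, Matrix.of_apply, Pi.star_apply, star_trivial]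
  refine Finset.sum_congr rfl fun i _ => Finset.sum_congr rfl fun j _ => ?_
  ring

/-- `D_n` is a positive multiple of the Hankel determinant of the moments `μ_{m+j+1}`. -/
theorem detD_pos {ν : ℝ} (hν : -1 < ν) (n : ℕ) : 0 < detD ν n := by
  have hΓ : 0 < Real.Gamma (1 + ν) := Real.Gamma_pos_of_pos (by linarith)
  have h : detD ν n = (∏ m : Fin n, Real.Gamma (1 + ν) * ((m : ℕ).factorial : ℝ)⁻¹) *
      (Matrix.of fun i j : Fin n => moment ν (i + j + 1)).det := by
    rw [← Matrix.det_mul_column, detD]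
    congr 1; ext i j
    simp [dCoeff_eq_moment hν, mul_assoc, add_assoc]
  rw [h]
  exact mul_pos (Finset.prod_pos fun m _ => by positivity) (det_hankel_pos hν n 1)

/-- Moving the replaced last column of `D_{n,n}` to the front costs the sign of an `n`-cycle. -/
theorem neg_one_pow_mul_detDr_self_pos {ν : ℝ} (hν : -1 < ν) (n : ℕ) :
    0 < (-1) ^ n * detDr ν (n + 1) (n + 1) := by
  have hΓ : 0 < Real.Gamma (1 + ν) := Real.Gamma_pos_of_pos (by linarith)
  have h : detDr ν (n + 1) (n + 1) =
      (∏ m : Fin (n + 1), Real.Gamma (1 + ν) * ((m : ℕ).factorial : ℝ)⁻¹) * ((-1) ^ n *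
      (Matrix.of fun i j : Fin (n + 1) => moment ν (i + j + 0)).det) := by
    have hs : ((Equiv.Perm.sign (finRotate (n + 1)) : ℤ) : ℝ) = (-1) ^ n := by
      simp [sign_finRotate]
    rw [← hs, ← Matrix.det_permute', ← Matrix.det_mul_column, detDr, if_neg (Nat.succ_ne_zero n)]
    congr 1; ext i j
    simp only [Matrix.of_apply, Matrix.submatrix_apply, id, dCoeff_eq_moment hν, mul_assoc]
    split_ifs with hj
    · have : j = Fin.last n := Fin.ext (by simpa using hj)
      simp [this]
    · have : (j : ℕ) < n := lt_of_le_of_ne (Nat.lt_succ_iff.1 j.2) (by simpa using hj)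
      rw [coe_finRotate_of_ne_last (fun h => by simp [h] at this)]
      simp
  rw [h, mul_left_comm, ← mul_assoc ((-1 : ℝ) ^ n), ← mul_pow]
  simp only [neg_mul_neg, mul_one, one_pow, one_mul]
  exact mul_pos (Finset.prod_pos fun m _ => by positivity) (det_hankel_pos hν (n + 1) 0)

theorem IsOrthonormalSeq.weightIntegral_mul {ν : ℝ} {P : ℕ → ℝ[X]} (hP : IsOrthonormalSeq ν P)
    (m n : ℕ) : weightIntegral ν (P m * P n) = if n = m then 1 else 0 := by
  simpa [weightIntegral] using hP.orthonormal m n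

theorem IsOrthonormalSeq.leadingCoeff_ne_zero {ν : ℝ} {P : ℕ → ℝ[X]} (hP : IsOrthonormalSeq ν P)
    (n : ℕ) : (P n).leadingCoeff ≠ 0 := by
  rw [Ne, leadingCoeff_eq_zero, ← degree_eq_bot, hP.degree_eq]
  simp

theorem IsOrthonormalSeq.natDegree_eq {ν : ℝ} {P : ℕ → ℝ[X]} (hP : IsOrthonormalSeq ν P)
    (n : ℕ) : (P n).natDegree = n :=
  natDegree_eq_of_degree_eq_some (hP.degree_eq n)

/-- Subtracting from `q` the multiple of `P_m` with the same coefficient of `x^m` lowers the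
degree. -/
theorem IsOrthonormalSeq.degree_sub_lt {ν : ℝ} {P : ℕ → ℝ[X]} (hP : IsOrthonormalSeq ν P)
    {q : ℝ[X]} {m : ℕ} (hq : q.degree < (m + 1 : ℕ)) :
    (q - C (q.coeff m / (P m).leadingCoeff) * P m).degree < m := by
  rw [degree_lt_iff_coeff_zero]
  intro j hj
  rcases eq_or_lt_of_le hj with rfl | hj
  · have h := hP.leadingCoeff_ne_zero m
    have h2 : (P m).coeff m = (P m).leadingCoeff := by rw [leadingCoeff, hP.natDegree_eq]
    rw [coeff_sub, coeff_C_mul, h2, div_mul_cancel₀ _ h, sub_self]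
  · rw [coeff_sub, coeff_C_mul, coeff_eq_zero_of_degree_lt (p := P m), mul_zero, sub_zero]
    · exact (degree_lt_iff_coeff_zero _ _).1 hq j hj
    · rw [hP.degree_eq]; exact_mod_cast hj

theorem IsOrthonormalSeq.weightIntegral_mul_of_degree_lt {ν : ℝ} (hν : -1 < ν) {P : ℕ → ℝ[X]}
    (hP : IsOrthonormalSeq ν P) {n m : ℕ} (hm : m ≤ n) {q : ℝ[X]} (hq : q.degree < m) :
    weightIntegral ν (P n * q) = 0 := by
  induction m generalizing q with
  | zero =>
    have : q = 0 := by
      rw [← degree_eq_bot]; exact Nat.WithBot.lt_zero_iff.1 (by simpa using hq)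
    simp [this, weightIntegral]
  | succ m ih =>
    have h := ih (by omega) (hP.degree_sub_lt hq)
    have e : P n * q = P n * (q - C (q.coeff m / (P m).leadingCoeff) * P m) +
        C (q.coeff m / (P m).leadingCoeff) * (P n * P m) := by ring
    rw [e, weightIntegral_add hν, h, weightIntegral_C_mul, hP.weightIntegral_mul,
      if_neg (by omega)]
    simp

theorem IsOrthonormalSeq.leadingCoeff_mul_weightIntegral {ν : ℝ} (hν : -1 < ν) {P : ℕ → ℝ[X]}
    (hP : IsOrthonormalSeq ν P) (n : ℕ) :
    (P n).leadingCoeff * weightIntegral ν (P n * X ^ n) = 1 := by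
  have h := hP.weightIntegral_mul_of_degree_lt hν le_rfl
    (hP.degree_sub_lt (q := X ^ n) (m := n) (by rw [degree_X_pow]; exact_mod_cast n.lt_succ_self))
  have e : P n * X ^ n = P n * (X ^ n - C ((X ^ n : ℝ[X]).coeff n / (P n).leadingCoeff) * P n) +
      C ((X ^ n : ℝ[X]).coeff n / (P n).leadingCoeff) * (P n * P n) := by ring
  have h0 := hP.leadingCoeff_ne_zero n
  rw [e, weightIntegral_add hν, h, weightIntegral_C_mul, hP.weightIntegral_mul]
  simp [h0]

theorem IsOrthonormalSeq.weightIntegral_mul_X_pow {ν : ℝ} (hν : -1 < ν) {P : ℕ → ℝ[X]}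
    (hP : IsOrthonormalSeq ν P) (n m : ℕ) :
    weightIntegral ν (P n * X ^ m) =
      ∑ k ∈ Finset.range (n + 1), (P n).coeff k * moment ν (k + m) := by
  conv_lhs => rw [(P n).as_sum_range_C_mul_X_pow, hP.natDegree_eq, Finset.sum_mul]
  rw [weightIntegral_sum hν]
  simp only [mul_assoc, ← pow_add, weightIntegral_C_mul, weightIntegral_X_pow]

/-- Cramer's rule for the orthogonality relations: `a_{n,r} D_n = -a_{n,0} D_{n,r}`. -/
theorem IsOrthonormalSeq.coeff_mul_detD {ν : ℝ} (hν : -1 < ν) {P : ℕ → ℝ[X]}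
    (hP : IsOrthonormalSeq ν P) {n r : ℕ} (hr : r ≤ n) :
    (P n).coeff r * detD ν n = -((P n).coeff 0 * detDr ν n r) := by
  rcases Nat.eq_zero_or_pos r with rfl | hr0
  · simp [detDr]
  obtain ⟨r, rfl⟩ := Nat.exists_eq_add_one_of_ne_zero hr0.ne'
  set A : Matrix (Fin n) (Fin n) ℝ := Matrix.of fun m j : Fin n => dCoeff ν (j + 1) m with hA
  set a : Fin n → ℝ := fun j => (P n).coeff (j + 1) with ha
  set b : Fin n → ℝ := fun m => dCoeff ν 0 m with hb
  have hAa : A.mulVec a = -((P n).coeff 0 • b) := by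
    ext m
    have h := hP.weightIntegral_mul_of_degree_lt hν (n := n) le_rfl (q := X ^ (m : ℕ))
      (by rw [degree_X_pow]; exact_mod_cast m.2)
    rw [hP.weightIntegral_mul_X_pow hν, Finset.sum_range_succ'] at h
    rw [Finset.sum_range fun k => (P n).coeff (k + 1) * moment ν (k + 1 + m)] at h
    simp only [Matrix.mulVec, dotProduct, hA, ha, hb, Matrix.of_apply, Pi.neg_apply, Pi.smul_apply,
      smul_eq_mul, dCoeff_eq_moment hν]
    have e : ∀ j : Fin n, Real.Gamma (1 + ν) * (((m : ℕ).factorial : ℝ)⁻¹ *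
        moment ν (m + (j + 1))) * (P n).coeff (j + 1) =
        Real.Gamma (1 + ν) * ((m : ℕ).factorial : ℝ)⁻¹ *
          ((P n).coeff (j + 1) * moment ν (j + 1 + m)) := by
      intro j; rw [add_comm (m : ℕ)]; ring
    simp only [e]
    rw [← Finset.mul_sum, add_zero]
    rw [zero_add] at h
    linear_combination (Real.Gamma (1 + ν) * ((m : ℕ).factorial : ℝ)⁻¹) * h
  have hcr : A.cramer (A.mulVec a) = A.det • a := by
    rw [Matrix.cramer_eq_adjugate_mulVec, Matrix.mulVec_mulVec, Matrix.adjugate_mul,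
      Matrix.smul_mulVec, Matrix.one_mulVec]
  have hr' : r < n := by omega
  have h := congrFun hcr ⟨r, hr'⟩
  rw [hAa, map_neg, map_smul] at h
  simp only [Pi.neg_apply, Pi.smul_apply, smul_eq_mul, Matrix.cramer_apply] at h
  have hD : (A.updateCol ⟨r, hr'⟩ b).det = detDr ν n (r + 1) := by
    rw [detDr, if_neg (Nat.succ_ne_zero r)]
    congr 1; ext i j
    simp [Matrix.updateCol_apply, hA, hb, Fin.ext_iff]
  rw [hD] at h
  rw [h, mul_comm]
  rfl

/-- Otherwise Cramer's rule with `D_n ≠ 0` would make all coefficients vanish. -/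
theorem IsOrthonormalSeq.coeff_zero_ne_zero {ν : ℝ} (hν : -1 < ν) {P : ℕ → ℝ[X]}
    (hP : IsOrthonormalSeq ν P) (n : ℕ) : (P n).coeff 0 ≠ 0 := by
  intro h
  have h1 := hP.coeff_mul_detD hν (le_refl n)
  rw [h, zero_mul, neg_zero] at h1
  have h2 := hP.leadingCoeff_ne_zero n
  rw [leadingCoeff, hP.natDegree_eq] at h2
  exact mul_ne_zero h2 (detD_pos hν n).ne' h1

/-- By Cramer's rule the sum `S_n` is a multiple of `∫ P_n(x) x^n e^{-x} ρ_ν(x) dx`, which is the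
reciprocal of the leading coefficient. -/
theorem IsOrthonormalSeq.detDr_mul_sumS {ν : ℝ} (hν : -1 < ν) {P : ℕ → ℝ[X]}
    (hP : IsOrthonormalSeq ν P) (n : ℕ) :
    detDr ν n n * sumS ν n = Real.Gamma (1 + ν) * (detD ν n / (P n).coeff 0) ^ 2 := by
  have ha0 := hP.coeff_zero_ne_zero hν n
  have hD := (detD_pos hν n).ne'
  have hS : (P n).coeff 0 * sumS ν n =
      -(Real.Gamma (1 + ν) * detD ν n * weightIntegral ν (P n * X ^ n)) := by
    rw [hP.weightIntegral_mul_X_pow hν, sumS, Finset.mul_sum, Finset.mul_sum,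
      ← Finset.sum_neg_distrib]
    refine Finset.sum_congr rfl fun k hk => ?_
    have h := hP.coeff_mul_detD hν (Nat.lt_succ_iff.1 (Finset.mem_range.1 hk))
    rw [dCoeff_eq_moment hν, add_zero, add_comm n k]
    have : ((k + n).factorial : ℝ) ≠ 0 := by positivity
    field_simp
    linear_combination moment ν (k + n) * Real.Gamma (1 + ν) * h
  have h1 := hP.coeff_mul_detD hν (le_refl n)
  have h2 := hP.leadingCoeff_mul_weightIntegral hν n
  rw [leadingCoeff, hP.natDegree_eq] at h2
  field_simp
  linear_combination (detDr ν n n * (P n).coeff 0) * hS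
    - Real.Gamma (1 + ν) * detD ν n * weightIntegral ν (P n * X ^ n) * h1
    + Real.Gamma (1 + ν) * detD ν n ^ 2 * h2

theorem IsOrthonormalSeq.coeff_zero_eq_freeCoeff {ν : ℝ} (hν : -1 < ν) {P : ℕ → ℝ[X]}
    (hP : IsOrthonormalSeq ν P) {n : ℕ} (hn : 1 ≤ n) :
    (P n).coeff 0 = freeCoeff ν n (Real.sign (P n).leadingCoeff) := by
  have hΓ : 0 < Real.Gamma (1 + ν) := Real.Gamma_pos_of_pos (by linarith)
  have ha0 := hP.coeff_zero_ne_zero hν n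
  have hD := detD_pos hν n
  have h1 := hP.coeff_mul_detD hν (le_refl n)
  have hsq : Real.Gamma (1 + ν) / (detDr ν n n * sumS ν n) =
      ((P n).coeff 0 / detD ν n) ^ 2 := by
    rw [hP.detDr_mul_sumS hν]; field_simp
  -- the sign of `a_{n,n} = -a_{n,0} D_{n,n} / D_n`, where `D_{n,n}` has the sign `(-1) ^ (n - 1)`
  have hsgn : Real.sign (P n).leadingCoeff * (-1) ^ n = Real.sign ((P n).coeff 0) := by
    obtain ⟨n, rfl⟩ := Nat.exists_eq_add_one_of_ne_zero (by omega : n ≠ 0)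
    have h3 := neg_one_pow_mul_detDr_self_pos hν n
    have h4 : (P (n + 1)).leadingCoeff =
        (-1) ^ (n + 1) * ((P (n + 1)).coeff 0 *
          ((-1) ^ n * detDr ν (n + 1) (n + 1) / detD ν (n + 1))) := by
      rw [leadingCoeff, hP.natDegree_eq]
      have h5 : ((-1 : ℝ) ^ n) ^ 2 = 1 := by rw [← pow_mul, mul_comm, pow_mul]; simp
      field_simp
      rw [h1, pow_succ]
      linear_combination ((P (n + 1)).coeff 0 * detDr ν (n + 1) (n + 1)) * h5
    have h6 : 0 < (-1) ^ n * detDr ν (n + 1) (n + 1) / detD ν (n + 1) := div_pos h3 hD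
    rw [h4]
    rcases neg_one_pow_eq_or ℝ (n + 1) with h | h <;> rcases lt_or_gt_of_ne ha0 with h9 | h9
    · rw [h, one_mul, mul_one, Real.sign_of_neg h9, Real.sign_of_neg
        (mul_neg_of_neg_of_pos h9 h6)]
    · rw [h, one_mul, mul_one, Real.sign_of_pos h9, Real.sign_of_pos (mul_pos h9 h6)]
    · rw [h, neg_one_mul, Real.sign_neg, Real.sign_of_neg h9, Real.sign_of_neg
        (mul_neg_of_neg_of_pos h9 h6)]
      norm_num
    · rw [h, neg_one_mul, Real.sign_neg, Real.sign_of_pos h9,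
        Real.sign_of_pos (mul_pos h9 h6)]
      norm_num
  rw [freeCoeff, hsq, Real.sqrt_sq_eq_abs, hsgn, abs_div, abs_of_pos hD,
    mul_div_cancel₀ _ hD.ne']
  rcases lt_or_gt_of_ne ha0 with h | h
  · rw [Real.sign_of_neg h, abs_of_neg h]; ring
  · rw [Real.sign_of_pos h, abs_of_pos h]; ring

/-! ### Derivatives of Riemann–Liouville integrals -/

theorem hasDerivAt_integral_Ioi {g : ℝ → ℝ} (hg : ContinuousOn g (Ioi 0))
    (hint : IntegrableOn g (Ioi 0)) {x : ℝ} (hx : 0 < x) :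
    HasDerivAt (fun y => ∫ t in Ioi y, g t) (-g x) x := by
  have hx2 : 0 < x / 2 := by linarith
  have hsub : ∀ {y : ℝ}, 0 < y → IntegrableOn g (Ioi y) := fun hy =>
    hint.mono_set (Ioi_subset_Ioi hy.le)
  have hcont : ContinuousAt g x := hg.continuousAt (Ioi_mem_nhds hx)
  have hd : HasDerivAt (fun y => ∫ t in (x / 2)..y, g t) (g x) x := by
    refine intervalIntegral.integral_hasDerivAt_right ?_ ?_ hcont
    · refine (hg.mono fun t ht => ?_).intervalIntegrable
      rw [uIcc_of_le (by linarith)] at ht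
      exact hx2.trans_le ht.1
    · exact hg.stronglyMeasurableAtFilter isOpen_Ioi x hx
  refine ((hd.const_sub (∫ t in Ioi (x / 2), g t))).congr_of_eventuallyEq ?_
  filter_upwards [Ioi_mem_nhds hx] with y hy
  rw [← intervalIntegral.integral_Ioi_sub_Ioi' (hsub hx2) (hsub hy)]
  ring

/-- The truncated moment `∫_x^∞ (t - x)^N f(t) dt`, which is `N!` times the Riemann–Liouville
integral of `f` of order `N + 1`. -/
noncomputable def truncMoment (f : ℝ → ℝ) (N : ℕ) (x : ℝ) : ℝ :=
  ∫ t in Ioi x, (t - x) ^ N * f t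

theorem sub_pow_mul_eq_sum (f : ℝ → ℝ) (N : ℕ) (x t : ℝ) :
    (t - x) ^ N * f t =
      ∑ j ∈ Finset.range (N + 1), (N.choose j * (-x) ^ (N - j)) * (t ^ j * f t) := by
  rw [sub_eq_add_neg, add_pow, Finset.sum_mul]
  exact Finset.sum_congr rfl fun j _ => by ring

theorem integrableOn_sub_pow_mul {f : ℝ → ℝ}
    (hint : ∀ j : ℕ, IntegrableOn (fun t => t ^ j * f t) (Ioi 0))
    (N : ℕ) {x : ℝ} (hx : 0 ≤ x) :
    IntegrableOn (fun t => (t - x) ^ N * f t) (Ioi x) := by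
  simp only [sub_pow_mul_eq_sum]
  exact integrable_finsetSum _ fun j _ => ((hint j).mono_set (Ioi_subset_Ioi hx)).const_mul _

theorem truncMoment_eq_sum {f : ℝ → ℝ}
    (hint : ∀ j : ℕ, IntegrableOn (fun t => t ^ j * f t) (Ioi 0))
    (N : ℕ) {x : ℝ} (hx : 0 ≤ x) :
    truncMoment f N x = ∑ j ∈ Finset.range (N + 1),
      (N.choose j * (-x) ^ (N - j)) * ∫ t in Ioi x, t ^ j * f t := by
  simp only [truncMoment, sub_pow_mul_eq_sum, ← integral_const_mul]
  exact integral_finsetSum _ fun j _ => ((hint j).mono_set (Ioi_subset_Ioi hx)).const_mul _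

theorem hasDerivAt_truncMoment_zero {f : ℝ → ℝ}
    (hint : ∀ j : ℕ, IntegrableOn (fun t => t ^ j * f t) (Ioi 0))
    (hf : ContinuousOn f (Ioi 0)) {x : ℝ} (hx : 0 < x) :
    HasDerivAt (truncMoment f 0) (-f x) x := by
  have h := hasDerivAt_integral_Ioi hf (by simpa using hint 0) hx
  have he : truncMoment f 0 = fun y => ∫ t in Ioi y, f t := by ext y; simp [truncMoment]
  rwa [he]

/-- The binomial expansion separates `x` from the variable of integration, so that only tails
`∫_x^∞ t^j f(t) dt` have to be differentiated. -/
theorem hasDerivAt_truncMoment_succ {f : ℝ → ℝ}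
    (hint : ∀ j : ℕ, IntegrableOn (fun t => t ^ j * f t) (Ioi 0))
    (hf : ContinuousOn f (Ioi 0)) (N : ℕ) {x : ℝ} (hx : 0 < x) :
    HasDerivAt (truncMoment f (N + 1)) (-((N + 1 : ℕ) * truncMoment f N x)) x := by
  have hT : ∀ j : ℕ, HasDerivAt (fun y => ∫ t in Ioi y, t ^ j * f t) (-(x ^ j * f x)) x :=
    fun j => hasDerivAt_integral_Ioi (by fun_prop) (hint j) hx
  have hterm : ∀ j ∈ Finset.range (N + 2), HasDerivAt
      (fun y => ((N + 1).choose j * (-y) ^ (N + 1 - j)) * ∫ t in Ioi y, t ^ j * f t)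
      (-(((N + 1).choose j * (N + 1 - j : ℕ) * (-x) ^ (N + 1 - j - 1)) *
          ∫ t in Ioi x, t ^ j * f t)
        - ((N + 1).choose j * (-x) ^ (N + 1 - j)) * (x ^ j * f x)) x := by
    intro j _
    have h := ((((hasDerivAt_id x).neg.pow (N + 1 - j)).const_mul
      ((N + 1).choose j : ℝ))).mul (hT j)
    refine h.congr_deriv ?_
    simp
    ring
  have h := (HasDerivAt.fun_sum hterm).congr_of_eventuallyEq (f₁ := truncMoment f (N + 1)) (by
    filter_upwards [Ioi_mem_nhds hx] with y hy using truncMoment_eq_sum hint (N + 1) (le_of_lt hy))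
  refine h.congr_deriv ?_
  -- the boundary terms recombine to `(x - x) ^ (N + 1) * f x`
  rw [Finset.sum_sub_distrib, ← sub_pow_mul_eq_sum f (N + 1) x x, sub_self, zero_pow N.succ_ne_zero,
    zero_mul, sub_zero, Finset.sum_neg_distrib, Finset.sum_range_succ,
    truncMoment_eq_sum hint N hx.le, Finset.mul_sum]
  simp only [Nat.sub_self, Nat.cast_zero, mul_zero, zero_mul, add_zero]
  congr 1
  refine Finset.sum_congr rfl fun j hj => ?_
  have hj' : j ≤ N := Nat.lt_succ_iff.1 (Finset.mem_range.1 hj)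
  have hch : (N.choose j : ℝ) * (N + 1 : ℕ) = (N + 1).choose j * (N + 1 - j : ℕ) := by
    exact_mod_cast Nat.choose_mul_succ_eq N j
  rw [← hch, show N + 1 - j - 1 = N - j by omega]
  ring

theorem deriv_truncMoment_succ {f : ℝ → ℝ}
    (hint : ∀ j : ℕ, IntegrableOn (fun t => t ^ j * f t) (Ioi 0))
    (hf : ContinuousOn f (Ioi 0)) (N : ℕ) :
    EqOn (deriv (truncMoment f (N + 1))) (fun x => -((N + 1 : ℕ) : ℝ) * truncMoment f N x)
      (Ioi 0) := fun x hx => by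
  rw [(hasDerivAt_truncMoment_succ hint hf N hx).deriv]
  exact (neg_mul _ _).symm

open scoped ContDiff in
theorem contDiffOn_truncMoment {f : ℝ → ℝ}
    (hint : ∀ j : ℕ, IntegrableOn (fun t => t ^ j * f t) (Ioi 0))
    (hf : ContDiffOn ℝ ∞ f (Ioi 0)) (N : ℕ) : ContDiffOn ℝ ∞ (truncMoment f N) (Ioi 0) := by
  induction N with
  | zero =>
    rw [contDiffOn_infty_iff_deriv_of_isOpen isOpen_Ioi]
    refine ⟨fun x hx => (hasDerivAt_truncMoment_zero hint hf.continuousOn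
      hx).differentiableAt.differentiableWithinAt, hf.neg.congr fun x hx => ?_⟩
    rw [(hasDerivAt_truncMoment_zero hint hf.continuousOn hx).deriv]
  | succ N ih =>
    rw [contDiffOn_infty_iff_deriv_of_isOpen isOpen_Ioi]
    refine ⟨fun x hx => (hasDerivAt_truncMoment_succ hint hf.continuousOn N
      hx).differentiableAt.differentiableWithinAt, ?_⟩
    exact (contDiffOn_const.mul ih).congr (deriv_truncMoment_succ hint hf.continuousOn N)

theorem iteratedDeriv_truncMoment {f : ℝ → ℝ}
    (hint : ∀ j : ℕ, IntegrableOn (fun t => t ^ j * f t) (Ioi 0))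
    (hf : ContinuousOn f (Ioi 0)) (N : ℕ) :
    EqOn (iteratedDeriv (N + 1) (truncMoment f N))
      (fun x => (-1) ^ (N + 1) * (N.factorial * f x)) (Ioi 0) := by
  induction N with
  | zero =>
    intro x hx
    simp [iteratedDeriv_one, (hasDerivAt_truncMoment_zero hint hf hx).deriv]
  | succ N ih =>
    intro x hx
    rw [iteratedDeriv_succ', (deriv_truncMoment_succ hint hf N).iteratedDeriv_of_isOpen
      isOpen_Ioi (N + 1) hx, iteratedDeriv_const_mul_field, ih hx, Nat.factorial_succ]
    push_cast
    ring

theorem rpow_sub_mul_eq (f : ℝ → ℝ) (N : ℕ) (x t : ℝ) :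
    (t - x) ^ (((N + 1 : ℕ) : ℝ) - 1) * f t = (t - x) ^ N * f t := by
  rw [Nat.cast_succ, add_sub_cancel_right, Real.rpow_natCast]

theorem rlIntegral_succ (f : ℝ → ℝ) (N : ℕ) :
    rlIntegral ((N + 1 : ℕ) : ℝ) f = fun x => (N.factorial : ℝ)⁻¹ * truncMoment f N x := by
  ext x
  simp only [rlIntegral, rpow_sub_mul_eq, truncMoment]
  rw [Nat.cast_succ, Real.Gamma_nat_eq_factorial]

/-! ### Conjugated derivatives commute -/

section

open scoped ContDiff

theorem contDiffOn_iteratedDeriv {g : ℝ → ℝ} {s : Set ℝ} (hs : IsOpen s)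
    (hg : ContDiffOn ℝ ∞ g s) (i : ℕ) : ContDiffOn ℝ ∞ (iteratedDeriv i g) s := by
  induction i generalizing g with
  | zero => simpa using hg
  | succ i ih =>
    rw [iteratedDeriv_succ']
    exact ih ((contDiffOn_infty_iff_deriv_of_isOpen hs).1 hg).2

theorem iteratedDeriv_comm (i n : ℕ) (g : ℝ → ℝ) :
    iteratedDeriv n (iteratedDeriv i g) = iteratedDeriv i (iteratedDeriv n g) := by
  simp only [iteratedDeriv_eq_iterate, ← Function.iterate_add_apply, add_comm]

/-- `e^{-y} D^k e^y = (D + 1)^k`, by Leibniz's rule. -/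
theorem exp_neg_mul_iteratedDeriv_exp_mul {g : ℝ → ℝ} {s : Set ℝ} (hs : IsOpen s)
    (hg : ContDiffOn ℝ ∞ g s) (k : ℕ) {y : ℝ} (hy : y ∈ s) :
    Real.exp (-y) * iteratedDeriv k (fun z => Real.exp z * g z) y =
      ∑ i ∈ Finset.range (k + 1), k.choose i * iteratedDeriv (k - i) g y := by
  have hgy : ContDiffAt ℝ k g y :=
    (hg.contDiffAt (hs.mem_nhds hy)).of_le (by exact_mod_cast le_top)
  rw [iteratedDeriv_fun_mul Real.contDiff_exp.contDiffAt hgy, Finset.mul_sum]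
  refine Finset.sum_congr rfl fun i _ => ?_
  rw [iteratedDeriv_eq_iterate, Real.iter_deriv_exp, Real.exp_neg]
  field_simp

/-- `D^n` commutes with `e^{-x} D^k e^x`, which is a polynomial in `D`. -/
theorem iteratedDeriv_exp_neg_mul {g : ℝ → ℝ} {s : Set ℝ} (hs : IsOpen s)
    (hg : ContDiffOn ℝ ∞ g s) (n k : ℕ) {x : ℝ} (hx : x ∈ s) :
    iteratedDeriv n (fun y => Real.exp (-y) * iteratedDeriv k (fun z => Real.exp z * g z) y) x =
      Real.exp (-x) * iteratedDeriv k (fun z => Real.exp z * iteratedDeriv n g z) x := by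
  have h : EqOn (fun y => Real.exp (-y) * iteratedDeriv k (fun z => Real.exp z * g z) y)
      (fun y => ∑ i ∈ Finset.range (k + 1), k.choose i * iteratedDeriv (k - i) g y) s :=
    fun y hy => exp_neg_mul_iteratedDeriv_exp_mul hs hg k hy
  rw [h.iteratedDeriv_of_isOpen hs n hx, iteratedDeriv_fun_sum,
    exp_neg_mul_iteratedDeriv_exp_mul hs (contDiffOn_iteratedDeriv hs hg n) k hx]
  · refine Finset.sum_congr rfl fun i _ => ?_
    rw [iteratedDeriv_const_mul_field, iteratedDeriv_comm]
  · intro i _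
    exact contDiffAt_const.mul (((contDiffOn_iteratedDeriv hs hg _).contDiffAt
      (hs.mem_nhds hx)).of_le (by exact_mod_cast le_top))

end

/-! ### The terms of the Rodrigues-type formula -/

section

open scoped ContDiff

theorem contDiffOn_pow_mul_exp_mul_rho (ν : ℝ) (k : ℕ) :
    ContDiffOn ℝ ∞ (fun t => t ^ k * Real.exp (-t) * rho ν t) (Ioi 0) :=
  ((contDiff_id.pow k).mul (Real.contDiff_exp.comp contDiff_neg)).contDiffOn.mul (contDiffOn_rho ν)

theorem integrableOn_pow_mul_exp_mul_rho {ν : ℝ} (hν : -1 < ν) (k j : ℕ) :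
    IntegrableOn (fun t => t ^ j * (t ^ k * Real.exp (-t) * rho ν t)) (Ioi 0) := by
  have h : (fun t => t ^ j * (t ^ k * Real.exp (-t) * rho ν t)) =
      fun t => t ^ (j + k) * (Real.exp (-t) * rho ν t) := by
    ext t; ring
  rw [h]
  exact integrableOn_weight hν (j + k)

theorem contDiffOn_rlIntegral {ν : ℝ} (hν : -1 < ν) {n : ℕ} (hn : 1 ≤ n) (k : ℕ) :
    ContDiffOn ℝ ∞ (rlIntegral n fun t => t ^ k * Real.exp (-t) * rho ν t) (Ioi 0) := by
  obtain ⟨N, rfl⟩ := Nat.exists_eq_add_one_of_ne_zero (by omega : n ≠ 0)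
  rw [rlIntegral_succ]
  exact contDiffOn_const.mul (contDiffOn_truncMoment (integrableOn_pow_mul_exp_mul_rho hν k)
    (contDiffOn_pow_mul_exp_mul_rho ν k) N)

theorem contDiffOn_innerFun {ν : ℝ} (hν : -1 < ν) {n : ℕ} (hn : 1 ≤ n) (k : ℕ) :
    ContDiffOn ℝ ∞ (innerFun ν n k) (Ioi 0) :=
  Real.contDiff_exp.contDiffOn.mul (contDiffOn_rlIntegral hν hn k)

/-- `D^n I_-^n = (-1)^n` on the functions `t^k e^{-t} ρ_ν(t)`. -/
theorem iteratedDeriv_rlIntegral {ν : ℝ} (hν : -1 < ν) {n : ℕ} (hn : 1 ≤ n) (k : ℕ) :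
    EqOn (iteratedDeriv n (rlIntegral n fun t => t ^ k * Real.exp (-t) * rho ν t))
      (fun x => (-1) ^ n * (x ^ k * Real.exp (-x) * rho ν x)) (Ioi 0) := by
  obtain ⟨N, rfl⟩ := Nat.exists_eq_add_one_of_ne_zero (by omega : n ≠ 0)
  intro x hx
  rw [rlIntegral_succ, iteratedDeriv_const_mul_field,
    iteratedDeriv_truncMoment (integrableOn_pow_mul_exp_mul_rho hν k)
      (contDiffOn_pow_mul_exp_mul_rho ν k).continuousOn N hx]
  have : (N.factorial : ℝ) ≠ 0 := by positivity
  field_simp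

/-- The fractional integral and the exponentials cancel: the Rodrigues term is
`(-1)^n D^k (x^k ρ_ν) / ρ_ν`. -/
theorem rodriguesTerm_eq {ν : ℝ} (hν : -1 < ν) {n : ℕ} (hn : 1 ≤ n) (k : ℕ) {x : ℝ} (hx : 0 < x) :
    rodriguesTerm ν n k x =
      (-1) ^ n * (iteratedDeriv k (fun y => y ^ k * rho ν y) x / rho ν x) := by
  have h := iteratedDeriv_exp_neg_mul isOpen_Ioi (contDiffOn_rlIntegral hν hn k) n k hx
  have h2 : EqOn (fun z => Real.exp z * iteratedDeriv n
      (rlIntegral n fun t => t ^ k * Real.exp (-t) * rho ν t) z)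
      (fun z => (-1) ^ n * (z ^ k * rho ν z)) (Ioi 0) := by
    intro z hz
    have h3 := iteratedDeriv_rlIntegral hν hn k hz
    beta_reduce at h3 ⊢
    rw [h3, Real.exp_neg]
    field_simp
  rw [h2.iteratedDeriv_of_isOpen isOpen_Ioi k hx, iteratedDeriv_const_mul_field] at h
  unfold rodriguesTerm innerFun
  rw [h, Real.exp_neg]
  field_simp

end

/-! ### Polynomials in the Euler operator applied to the weight -/

/-- The function `θ^j ρ_ν`, where `θ = x d/dx` is the Euler operator. -/
noncomputable def eulerRho (ν : ℝ) : ℕ → ℝ → ℝ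
  | 0 => rho ν
  | j + 1 => fun x => x * deriv (eulerRho ν j) x

/-- The value `(p(θ) ρ_ν)(x)`, as a linear functional of the polynomial `p`. -/
noncomputable def eulerEval (ν x : ℝ) : ℝ[X] →ₗ[ℝ] ℝ :=
  Polynomial.lsum fun j => LinearMap.id.smulRight (eulerRho ν j x)

theorem eulerEval_monomial (ν x : ℝ) (j : ℕ) (a : ℝ) :
    eulerEval ν x (monomial j a) = a * eulerRho ν j x := by
  simp [eulerEval, lsum_apply, sum_monomial_index]

theorem eulerEval_C_mul (ν x a : ℝ) (p : ℝ[X]) :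
    eulerEval ν x (C a * p) = a * eulerEval ν x p := by
  rw [← smul_eq_C_mul, map_smul, smul_eq_mul]

theorem eulerEval_one (ν x : ℝ) : eulerEval ν x 1 = rho ν x := by
  rw [← C_1, ← monomial_zero_left, eulerEval_monomial, one_mul, eulerRho]

open scoped ContDiff in
theorem contDiffOn_eulerRho (ν : ℝ) (j : ℕ) : ContDiffOn ℝ ∞ (eulerRho ν j) (Ioi 0) := by
  induction j with
  | zero => exact contDiffOn_rho ν
  | succ j ih =>
    exact contDiffOn_id.mul ((contDiffOn_infty_iff_deriv_of_isOpen isOpen_Ioi).1 ih).2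

/-- On values `p(θ) ρ_ν`, differentiation is multiplication of `p` by the variable, up to the
factor `x`. -/
theorem hasDerivAt_eulerEval (ν : ℝ) (p : ℝ[X]) {x : ℝ} (hx : 0 < x) :
    HasDerivAt (fun y => eulerEval ν y p) (eulerEval ν x (X * p) / x) x := by
  induction p using Polynomial.induction_on' with
  | add p q hp hq =>
    simp only [mul_add, map_add, add_div]
    exact hp.add hq
  | monomial j a =>
    simp only [X_mul_monomial, eulerEval_monomial, eulerRho]
    have h : DifferentiableAt ℝ (eulerRho ν j) x :=
      ((contDiffOn_eulerRho ν j).contDiffAt (Ioi_mem_nhds hx)).differentiableAt (by simp)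
    refine (h.hasDerivAt.const_mul a).congr_deriv ?_
    field_simp

/-- Bessel's equation in the form `θ (θ - ν) ρ_ν = x ρ_ν`. -/
theorem eulerEval_X_mul_X_sub (ν : ℝ) {x : ℝ} (hx : 0 < x) :
    eulerEval ν x (X * (X - C ν)) = x * rho ν x := by
  have h1 : ∀ {y : ℝ}, 0 < y → eulerRho ν 1 y = ν * rho ν y - rho (ν + 1) y := by
    intro y hy
    have h : eulerRho ν 1 y = y * deriv (rho ν) y := rfl
    rw [h, (hasDerivAt_rho ν hy).deriv, rho_add_one ν hy]
    ring
  have h2 : eulerRho ν 2 x = ν * eulerRho ν 1 x + x * rho ν x := by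
    have h : eulerRho ν 2 x = x * deriv (eulerRho ν 1) x := rfl
    have hd : HasDerivAt (fun y => ν * rho ν y - rho (ν + 1) y)
        (ν * -rho (ν - 1) x - -rho (ν + 1 - 1) x) x :=
      ((hasDerivAt_rho ν hx).const_mul ν).sub (hasDerivAt_rho (ν + 1) hx)
    rw [h, (hd.congr_of_eventuallyEq (f₁ := eulerRho ν 1)
      (by filter_upwards [Ioi_mem_nhds hx] with y hy using h1 hy)).deriv, h1 hx,
      rho_add_one ν hx, add_sub_cancel_right]
    ring
  have hp : X * (X - C ν) = monomial 2 (1 : ℝ) - monomial 1 ν := by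
    rw [← C_mul_X_pow_eq_monomial, ← C_mul_X_pow_eq_monomial, C_1]; ring
  rw [hp, map_sub, eulerEval_monomial, eulerEval_monomial, h2]
  ring

/-- Multiplication by `x` shifts the Euler operator: `x p(θ) = p(θ - 1) x`. -/
theorem mul_eulerEval (ν : ℝ) (p : ℝ[X]) {x : ℝ} (hx : 0 < x) :
    x * eulerEval ν x p = eulerEval ν x (p.comp (X - 1) * (X * (X - C ν))) := by
  induction p using Polynomial.induction_on generalizing x with
  | C a =>
    rw [C_comp, eulerEval_C_mul, eulerEval_X_mul_X_sub ν hx, ← mul_one (C a), eulerEval_C_mul,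
      eulerEval_one]
    ring
  | add p q hp hq => rw [map_add, mul_add, hp hx, hq hx, add_comp, add_mul, map_add]
  | monomial n a ih =>
    set p := C a * X ^ n with hp
    set q := p.comp (X - 1) * (X * (X - C ν)) with hq
    have e1 : C a * X ^ (n + 1) = X * p := by rw [hp]; ring
    have hd := ((hasDerivAt_id x).mul (hasDerivAt_eulerEval ν p hx)).congr_of_eventuallyEq
      (f₁ := fun y => eulerEval ν y q)
      (by filter_upwards [Ioi_mem_nhds hx] with y hy using (ih hy).symm)
    have h := hd.unique (hasDerivAt_eulerEval ν q hx)
    have e2 : (X * p).comp (X - 1) * (X * (X - C ν)) = X * q - q := by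
      rw [mul_comp, X_comp, hq]; ring
    rw [e1, e2, map_sub, ← ih hx]
    simp only [id] at h
    field_simp at h
    linear_combination h

/-- Iterating Bessel's equation: `x^r ρ_ν = ∏_{j<r} (θ - j) (θ - ν - j) ρ_ν`. -/
theorem pow_mul_rho_eq_eulerEval (ν : ℝ) (r : ℕ) {x : ℝ} (hx : 0 < x) :
    x ^ r * rho ν x =
      eulerEval ν x (∏ j ∈ Finset.range r, (X - C (j : ℝ)) * (X - C (ν + j))) := by
  induction r with
  | zero => simp [eulerEval_one]
  | succ r ih =>
    rw [pow_succ', mul_assoc, ih, mul_eulerEval ν _ hx, Finset.prod_range_succ', prod_comp]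
    congr 2
    · refine Finset.prod_congr rfl fun j _ => ?_
      simp only [mul_comp, sub_comp, add_comp, X_comp, C_comp, Nat.cast_succ, C_add, C_1]
      ring
    · simp

/-- Each derivative lowers the power of `x` by one and contributes a factor of the form
`θ + (current exponent)`. -/
theorem iteratedDeriv_pow_mul_eulerEval (ν : ℝ) (p : ℝ[X]) (k : ℕ) {i : ℕ} (hi : i ≤ k) :
    EqOn (iteratedDeriv i fun y => y ^ k * eulerEval ν y p)
      (fun y => y ^ (k - i) *
        eulerEval ν y (p * ∏ l ∈ Finset.range i, (X + C ((k : ℝ) - l)))) (Ioi 0) := by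
  induction i with
  | zero => intro x _; simp
  | succ i ih =>
    intro x hx
    have hx0 : (0 : ℝ) < x := hx
    obtain ⟨d, hd⟩ := Nat.exists_eq_add_of_le hi
    have hki : k - i = d + 1 := by omega
    have hkr : (k : ℝ) - i = d + 1 := by rw [hd]; push_cast; ring
    rw [iteratedDeriv_succ]
    set q := p * ∏ l ∈ Finset.range i, (X + C ((k : ℝ) - l)) with hq
    have h := ((hasDerivAt_pow (k - i) x).mul
      (hasDerivAt_eulerEval ν q hx0)).congr_of_eventuallyEq
      (f₁ := iteratedDeriv i fun y => y ^ k * eulerEval ν y p)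
      (by filter_upwards [Ioi_mem_nhds hx0] with y hy using ih (by omega) hy)
    have e : p * ∏ l ∈ Finset.range (i + 1), (X + C ((k : ℝ) - l)) =
        X * q + C ((k : ℝ) - i) * q := by
      rw [Finset.prod_range_succ, hq]; ring
    beta_reduce
    rw [h.deriv, e, map_add, eulerEval_C_mul, hkr, hki, show k - (i + 1) = d by omega]
    simp only [Nat.add_sub_cancel]
    push_cast
    field_simp
    ring

/-- `D^k x^k ρ_ν = (θ + 1) ⋯ (θ + k) ρ_ν`. -/
theorem iteratedDeriv_pow_mul_rho (ν : ℝ) (k : ℕ) {x : ℝ} (hx : 0 < x) :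
    iteratedDeriv k (fun y => y ^ k * rho ν y) x =
      eulerEval ν x (∏ l ∈ Finset.range k, (X + C ((k : ℝ) - l))) := by
  have h := iteratedDeriv_pow_mul_eulerEval ν 1 k le_rfl hx
  simpa [eulerEval_one] using h

/-! ### The hypergeometric coefficients as Newton interpolation coefficients -/

theorem poch_add (a : ℝ) (m n : ℕ) : poch a (m + n) = poch a m * poch (a + m) n := by
  rw [poch, poch, poch, ← ascPochhammer_mul, eval_mul, eval_comp]
  simp

theorem poch_one (n : ℕ) : poch 1 n = n.factorial := by
  rw [poch, ascPochhammer_eval_one]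

theorem poch_neg_natCast (k j : ℕ) :
    poch (-(k : ℝ)) j = (-1) ^ j * ((j.factorial : ℝ) * k.choose j) := by
  rw [poch, ascPochhammer_eval_neg_eq_descPochhammer, descPochhammer_eval_eq_descFactorial,
    Nat.descFactorial_eq_factorial_mul_choose]
  push_cast
  ring

theorem poch_eq_prod (a : ℝ) (n : ℕ) : poch a n = ∏ j ∈ Finset.range n, (a + j) := by
  induction n with
  | zero => simp [poch]
  | succ n ih => rw [Finset.prod_range_succ, ← ih, poch, poch, ascPochhammer_succ_eval]

/-- The series terminates, and the coefficients of the Rodrigues-type formula are alternating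
binomial sums. -/
theorem factorial_mul_poch_mul_hyp3F2 {ν : ℝ} (hν : -1 < ν) (r k : ℕ) :
    (r.factorial : ℝ) * poch (1 + ν) r * hyp3F2 (-(k : ℝ)) (1 + ν + r) (1 + r) (1 + ν) 1 1 =
      ∑ j ∈ Finset.range (k + 1),
        (-1) ^ j * (k.choose j : ℝ) * (poch (1 + j) r * poch (1 + ν + j) r) := by
  rw [hyp3F2, tsum_eq_sum (s := Finset.range (k + 1)), Finset.mul_sum]
  · refine Finset.sum_congr rfl fun j _ => ?_
    have h1 := poch_add (1 + ν) r j
    have h2 := poch_add (1 + ν) j r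
    have h3 := poch_add 1 r j
    have h4 := poch_add 1 j r
    rw [add_comm j r] at h2 h4
    rw [poch_one, poch_one] at h3 h4
    have h5 : poch (1 + ν) j ≠ 0 := (ascPochhammer_pos j _ (by linarith)).ne'
    have h6 : (j.factorial : ℝ) ≠ 0 := by positivity
    rw [poch_neg_natCast, poch_one, one_pow]
    field_simp
    have h7 := h1.symm.trans h2
    have h8 := h3.symm.trans h4
    linear_combination (k.choose j : ℝ) * (r.factorial * poch (1 + r) j) * h7
      + (k.choose j : ℝ) * (poch (1 + ν) j * poch (1 + ν + j) r) * h8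
  · intro j hj
    have hj' : k < j := by simpa [Nat.lt_succ_iff] using hj
    simp [poch_neg_natCast, Nat.choose_eq_zero_of_lt hj']

/-- At the point `-1 - z` the product `(X + 1) ⋯ (X + k)` is `(-z)_k`, so divided by `k!` it is a
signed binomial coefficient: these products are the Newton basis at `-1, -2, …`. -/
theorem eval_prod_X_add_C (k z : ℕ) :
    (∏ l ∈ Finset.range k, (X + C ((k : ℝ) - l))).eval (-1 - (z : ℝ)) =
      (-1) ^ k * ((k.factorial : ℝ) * z.choose k) := by
  rw [← poch_neg_natCast, poch_eq_prod, eval_prod, ← Finset.prod_range_reflect]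
  refine Finset.prod_congr rfl fun l hl => ?_
  have hl' : l + 1 ≤ k := Finset.mem_range.1 hl
  rw [Nat.sub_sub, add_comm 1 l, Nat.cast_sub hl']
  simp
  ring

/-- Newton's interpolation formula at the points `-1, -2, …` for the polynomial that expresses
multiplication by `x^r` through the Euler operator. -/
theorem prod_eq_sum_hyp3F2 {ν : ℝ} (hν : -1 < ν) (r : ℕ) :
    (∏ j ∈ Finset.range r, (X - C (j : ℝ)) * (X - C (ν + j))) =
      ∑ k ∈ Finset.range (2 * r + 1), C ((r.factorial : ℝ) * poch (1 + ν) r *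
        hyp3F2 (-(k : ℝ)) (1 + ν + r) (1 + r) (1 + ν) 1 1 / k.factorial) *
          ∏ l ∈ Finset.range k, (X + C ((k : ℝ) - l)) := by
  refine eq_of_degrees_lt_of_eval_index_eq (v := fun z : ℕ => -1 - (z : ℝ))
    (Finset.range (2 * r + 1)) ?_ ?_ ?_ ?_
  · intro a _ b _ h
    simpa using h
  · rw [Finset.card_range, degree_prod]
    refine lt_of_le_of_lt (Finset.sum_le_card_nsmul _ _ 2 fun j _ => ?_) ?_
    · rw [degree_mul, degree_X_sub_C, degree_X_sub_C]; rfl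
    · rw [Finset.card_range, nsmul_eq_mul]
      norm_cast
      omega
  · rw [Finset.card_range]
    refine lt_of_le_of_lt (degree_sum_le _ _) ((Finset.sup_lt_iff (WithBot.bot_lt_coe _)).2 ?_)
    intro k hk
    refine lt_of_le_of_lt (degree_mul_le _ _) ?_
    refine lt_of_le_of_lt (add_le_add degree_C_le le_rfl) ?_
    rw [zero_add, degree_prod]
    simp only [degree_X_add_C, Finset.sum_const, Finset.card_range, nsmul_eq_mul, mul_one]
    exact_mod_cast Finset.mem_range.1 hk
  · intro z hz
    have hz' : z + 1 ≤ 2 * r + 1 := Finset.mem_range.1 hz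
    set F : ℕ → ℝ := fun j => poch (1 + j) r * poch (1 + ν + j) r with hF
    have h1 : (∏ j ∈ Finset.range r, (X - C (j : ℝ)) * (X - C (ν + j))).eval (-1 - (z : ℝ)) =
        F z := by
      simp only [hF, poch_eq_prod, ← Finset.prod_mul_distrib, eval_prod, eval_mul, eval_sub, eval_X,
        eval_C]
      exact Finset.prod_congr rfl fun j _ => by ring
    have h2 := shift_eq_sum_fwdDiff_iter 1 F z 0
    rw [h1, eval_finsetSum]
    simp only [zero_add, smul_eq_mul, mul_one] at h2
    rw [h2, ← Finset.sum_subset (Finset.range_subset_range.2 hz')]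
    · refine Finset.sum_congr rfl fun k _ => ?_
      have hk : (k.factorial : ℝ) ≠ 0 := by positivity
      have hΔ : (fwdDiff 1)^[k] F 0 = (-1) ^ k * ∑ j ∈ Finset.range (k + 1),
          (-1) ^ j * (k.choose j : ℝ) * F j := by
        rw [fwdDiff_iter_eq_sum_shift, Finset.mul_sum]
        refine Finset.sum_congr rfl fun j hj => ?_
        obtain ⟨d, rfl⟩ := Nat.exists_eq_add_of_le (Nat.lt_succ_iff.1 (Finset.mem_range.1 hj))
        have hs : ((-1 : ℝ) ^ j) * (-1) ^ j = 1 := by rw [← mul_pow]; simp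
        simp only [zero_add, smul_eq_mul, mul_one, zsmul_eq_mul, Nat.add_sub_cancel_left, pow_add]
        push_cast
        linear_combination (-(-1) ^ d * ((j + d).choose j : ℝ) * F j) * hs
      rw [hΔ, eval_mul, eval_C, eval_prod_X_add_C, factorial_mul_poch_mul_hyp3F2 hν, nsmul_eq_mul]
      field_simp
      simp only [hF, mul_assoc]
    · intro k _ hk
      have hk' : z < k := by simpa [Nat.lt_succ_iff] using hk
      rw [eval_mul, eval_prod_X_add_C, Nat.choose_eq_zero_of_lt hk']
      simp

/-- Every monomial is a combination of Rodrigues terms, with coefficients independent of `n` up to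
the sign `(-1)^n`; the formula for `P_n` follows by linearity. -/
theorem pow_eq_sum_rodriguesTerm {ν : ℝ} (hν : -1 < ν) {n : ℕ} (hn : 1 ≤ n) (r : ℕ) {x : ℝ}
    (hx : 0 < x) :
    x ^ r = (-1) ^ n * ((r.factorial : ℝ) * poch (1 + ν) r *
      ∑ k ∈ Finset.range (2 * r + 1), 1 / (k.factorial : ℝ) *
        hyp3F2 (-(k : ℝ)) (1 + ν + r) (1 + r) (1 + ν) 1 1 * rodriguesTerm ν n k x) := by
  have hρ := (rho_pos ν hx).ne'
  have h := pow_mul_rho_eq_eulerEval ν r hx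
  rw [prod_eq_sum_hyp3F2 hν, map_sum] at h
  simp only [eulerEval_C_mul, ← iteratedDeriv_pow_mul_rho ν _ hx] at h
  rw [eq_div_of_mul_eq hρ h, Finset.sum_div, Finset.mul_sum, Finset.mul_sum]
  refine Finset.sum_congr rfl fun k _ => ?_
  have hs : ((-1 : ℝ) ^ n) * (-1) ^ n = 1 := by rw [← mul_pow]; simp
  rw [rodriguesTerm_eq hν hn k hx]
  field_simp
  rw [sq, hs, mul_one]

end PrudnikovOrth

open MeasureTheory Set Polynomial PrudnikovOrth
theorem theorem2 (ν : ℝ) (hν : -1 < ν) (P : ℕ → ℝ[X]) (hP : IsOrthonormalSeq ν P)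
    (n : ℕ) (hn : 1 ≤ n) :
    -- the free coefficient is well defined and given by the determinants
    detD ν n ≠ 0 ∧ 0 < detDr ν n n * sumS ν n ∧
    (P n).coeff 0 = freeCoeff ν n (Real.sign (P n).leadingCoeff) ∧
    -- the integrals converge and all the derivatives below exist
    (∀ k ≤ 2 * n, ∀ y : ℝ, 0 < y → IntegrableOn
      (fun t => (t - y) ^ ((n : ℝ) - 1) * (t ^ k * Real.exp (-t) * rho ν t)) (Ioi y)) ∧
    (∀ k ≤ 2 * n, ContDiffOn ℝ ((n + k : ℕ) : WithTop ℕ∞) (innerFun ν n k) (Ioi 0)) ∧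
    -- the Rodrigues-type formula
    ∀ x : ℝ, 0 < x →
      (P n).eval x =
        (-1) ^ (n + 1) * freeCoeff ν n (Real.sign (P n).leadingCoeff) / detD ν n *
          ∑ r ∈ Finset.range (n + 1), detDr ν n r * (r.factorial : ℝ) * poch (1 + ν) r *
            ∑ k ∈ Finset.range (2 * r + 1),
              1 / (k.factorial : ℝ) * hyp3F2 (-(k : ℝ)) (1 + ν + r) (1 + r) (1 + ν) 1 1 *
                rodriguesTerm ν n k x := by
  have hD := (detD_pos hν n).ne'
  have ha0 := hP.coeff_zero_ne_zero hν n
  have hΓ : 0 < Real.Gamma (1 + ν) := Real.Gamma_pos_of_pos (by linarith)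
  have hfree := hP.coeff_zero_eq_freeCoeff hν hn
  refine ⟨hD, ?_, hfree, fun k _ y hy => ?_, fun k _ => ?_, fun x hx => ?_⟩
  · rw [hP.detDr_mul_sumS hν]
    positivity
  · obtain ⟨N, rfl⟩ := Nat.exists_eq_add_one_of_ne_zero (by omega : n ≠ 0)
    simp only [rpow_sub_mul_eq (fun t => t ^ k * Real.exp (-t) * rho ν t)]
    exact integrableOn_sub_pow_mul (integrableOn_pow_mul_exp_mul_rho hν k) N hy.le
  · exact (contDiffOn_innerFun hν hn k).of_le (by exact_mod_cast le_top)
  · rw [← hfree, eval_eq_sum_range, hP.natDegree_eq, Finset.mul_sum]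
    refine Finset.sum_congr rfl fun r hr => ?_
    have hcr := hP.coeff_mul_detD hν (Nat.lt_succ_iff.1 (Finset.mem_range.1 hr))
    have hcr' : (P n).coeff r = -((P n).coeff 0 * detDr ν n r) / detD ν n :=
      eq_div_of_mul_eq hD hcr
    conv_lhs => rw [hcr', pow_eq_sum_rodriguesTerm hν hn r hx]
    ring
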